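/- Let $(M,\mathbf g,\tau_{\mathbf g},D)$ be a Lorentzian spacetime: a smooth four-dimensional manifold with a smooth Lorentzian metric $\mathbf g$ of signature $(1,3)$, metric volume form $\tau_{\mathbf g}$ and Levi-Civita connection $D$. Let $\mathtt g$ be the induced metric on $T^*M$ and regard $1$-forms as sections of the Clifford bundle $\mathcal{C}\ell(M,\mathtt g)$, where $ab+ba=2\,\mathtt g(a,b)$ for $1$-forms $a,b$. For a smooth local frame $\{e_\alpha\}$ of $TM$ over an open set $U$, with dual coframe $\{\theta^\alpha\}$, put $g^{\alpha\beta}=\mathtt g(\theta^\alpha,\theta^\beta)$ and $D_{e_\alpha}e_\beta=L^\rho_{\alpha\beta}e_\rho$. On $1$-form fields $A$ define the codifferential $\delta A=-\star^{-1}d\star A$ (with $\star A=\tau_{\mathbf g}(A^\sharp,\cdot,\cdot,\cdot)$ and $\star 1=\tau_{\mathbf g}$), the covariant D'Alembertian $$\square A=\boldsymbol\partial\cdot\boldsymbol\partial A=g^{\alpha\beta}\bigl(D_{e_\alpha}D_{e_\beta}-L^\rho_{\alpha\beta}D_{e_\rho}\bigr)A ,$$ and the Ricci operator $$\boldsymbol\partial\wedge\boldsymbol\partial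 A=\tfrac12(\theta^\alpha\wedge\theta^\beta)\bigl([D_{e_\alpha},D_{e_\beta}]-(L^\rho_{\alpha\beta}-L^\rho_{\beta\alpha})D_{e_\rho}\bigr)A ,$$ where the bivectors $\theta^\alpha\wedge\theta^\beta$ act by Clifford multiplication. Let $R(X,Y)Z=D_XD_YZ-D_YD_XZ-D_{[X,Y]}Z$, write $R(e_\sigma,e_\mu)e_\nu=R_\nu{}^\rho{}_{\sigma\mu}\,e_\rho$, let $R_{\nu\sigma}=R_\nu{}^\mu{}_{\sigma\mu}$ be the Ricci tensor (in this sign convention) and let $\mathcal R^\mu=R^\mu{}_\nu\,\theta^\nu$, with $R^\mu{}_\nu=g^{\mu\rho}R_{\rho\nu}$, be the Ricci $1$-forms. Let $\mathbf K$ be a smooth Killing vector field on $M$, i.e. $\pounds_{\mathbf K}\mathbf g=0$, and let $K=\mathbf g(\mathbf K,\cdot)$. Then $\delta K=0$ on $M$, and for every smooth local frame $\{e_\alpha\}$ over an open set $U$, with $K=K_\alpha\theta^\alpha$, on $U$ $$\boldsymbol\partial\wedge\boldsymbol\partial\,\theta^\alpha=\mathcal R^\alpha,\qquad \boldsymbol\partial\wedge\boldsymbol\partial\,K=K_\alpha\mathcal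 R^\alpha,\qquad \square K=\boldsymbol\partial\cdot\boldsymbol\partial K=K_\alpha\mathcal R^\alpha .$$ -/

import Mathlib

open scoped Manifold ContDiff

noncomputable section

/-- The model space `ℝ⁴`. -/
abbrev R4 : Type := EuclideanSpace ℝ (Fin 4)

variable {M : Type*} [TopologicalSpace M] [ChartedSpace R4 M]

/-- The tangent space `T_x M` of a four-dimensional manifold. -/
abbrev Tan (x : M) : Type := TangentSpace (𝓡 4) x

/-- The cotangent space `T*_x M`. -/
abbrev Cotan (x : M) : Type := Module.Dual ℝ (Tan x)

/-- The fibre at `x` of the bundle of differential `k`-forms. -/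
abbrev Form (k : ℕ) (x : M) : Type := Tan x [⋀^Fin k]→L[ℝ] ℝ

instance instFiniteDimensionalTan (x : M) : FiniteDimensional ℝ (TangentSpace (𝓡 4) x) :=
  inferInstanceAs (FiniteDimensional ℝ R4)

/-- The matrix `η = diag(1, -1, -1, -1)`. -/
def minkowskiEta : Matrix (Fin 4) (Fin 4) ℝ := Matrix.diagonal ![1, -1, -1, -1]

/-- The exterior derivative of a differential form on a manifold, computed at `x` in the preferred
chart at `x`: pull the form back to `ℝ⁴` along the inverse chart, differentiate, pull back. -/
def manifoldExtDeriv {k : ℕ} (w : Π x : M, Form k x) (x : M) : Form (k + 1) x :=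
  let pulled : R4 → R4 [⋀^Fin k]→L[ℝ] ℝ := fun y =>
    (w ((extChartAt (𝓡 4) x).symm y)).compContinuousLinearMap
      (mfderiv 𝓘(ℝ, R4) (𝓡 4) (extChartAt (𝓡 4) x).symm y)
  (extDeriv pulled (extChartAt (𝓡 4) x x)).compContinuousLinearMap
    (mfderiv (𝓡 4) 𝓘(ℝ, R4) (extChartAt (𝓡 4) x) x)

variable [IsManifold (𝓡 4) ∞ M]

/-- A vector field `X`, possibly only locally meaningful, is smooth on the set `U`. -/
def SmoothFieldOn (X : Π x : M, Tan x) (U : Set M) : Prop :=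
  ContMDiffOn (𝓡 4) ((𝓡 4).prod 𝓘(ℝ, R4)) ∞
    (fun x => Bundle.TotalSpace.mk' R4 (E := (TangentSpace (𝓡 4) : M → Type _)) x (X x)) U

variable (M) in
/-- A smooth Lorentzian metric of signature `(1,3)` on a four-dimensional manifold. -/
structure LorentzianMetric where
  /-- the metric tensor `g_x : T_x M × T_x M → ℝ` -/
  val : Π x : M, Tan x →L[ℝ] Tan x →L[ℝ] ℝ
  symm : ∀ (x : M) (v w : Tan x), val x v w = val x w v
  smooth : ContMDiff (𝓡 4) ((𝓡 4).prod 𝓘(ℝ, R4 →L[ℝ] R4 →L[ℝ] ℝ)) ∞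
    (fun x => Bundle.TotalSpace.mk' (R4 →L[ℝ] R4 →L[ℝ] ℝ)
      (E := fun x : M => TangentSpace (𝓡 4) x →L[ℝ] TangentSpace (𝓡 4) x →L[ℝ] ℝ) x (val x))
  signature : ∀ x : M, ∃ b : Module.Basis (Fin 4) ℝ (Tan x),
    ∀ i j, val x (b i) (b j) = minkowskiEta i j

variable (M) in
/-- A Lorentzian spacetime: a four-dimensional manifold with a Lorentzian metric `g`, an
orientation given by a metric volume form `τ_g`, and the Levi-Civita connection `D` of `g`
(`D Y x v` is `(D_v Y)(x)`). -/
structure Spacetime extends LorentzianMetric M where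
  /-- the metric volume form `τ_g` -/
  vol : Π x : M, Form 4 x
  vol_smooth : ∀ (U : Set M), IsOpen U → ∀ X : Fin 4 → Π x : M, Tan x,
    (∀ i, SmoothFieldOn (X i) U) →
      ContMDiffOn (𝓡 4) 𝓘(ℝ, ℝ) ∞ (fun x => vol x (fun i => X i x)) U
  vol_orthonormal : ∀ (x : M) (b : Fin 4 → Tan x),
    (∀ i j, val x (b i) (b j) = minkowskiEta i j) → |vol x b| = 1
  /-- the connection `D` on the tangent bundle -/
  D : CovariantDerivative (𝓡 4) R4 (TangentSpace (𝓡 4) : M → Type _)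
  D_smooth : ∀ U : Set M, IsOpen U → ContMDiffCovariantDerivativeOn R4 ∞ D.toFun U
  D_torsion : D.torsion = 0
  D_metric : ∀ (x : M) (v : Tan x) (Y Z : Π x : M, Tan x),
    MDifferentiableAt (𝓡 4) ((𝓡 4).prod 𝓘(ℝ, R4))
      (fun y => Bundle.TotalSpace.mk' R4 (E := (TangentSpace (𝓡 4) : M → Type _)) y (Y y)) x →
    MDifferentiableAt (𝓡 4) ((𝓡 4).prod 𝓘(ℝ, R4))
      (fun y => Bundle.TotalSpace.mk' R4 (E := (TangentSpace (𝓡 4) : M → Type _)) y (Z y)) x →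
    mvfderiv (𝓡 4) (fun y => val y (Y y) (Z y)) x v
      = val x (D Y x v) (Z x) + val x (Y x) (D Z x v)

variable (M) in
/-- An arbitrary smooth local frame `{e_α}` of `TM` over an open set `U` (for instance a coordinate
or an orthonormal one). The sections `e_α` are meaningful on `U` only. -/
structure LocalFrame where
  U : Set M
  isOpen : IsOpen U
  e : Fin 4 → Π x : M, Tan x
  isFrame : IsLocalFrameOn (𝓡 4) R4 ∞ e U

/-- The dual coframe `{θ^α}`, `θ^α(e_β) = δ^α_β` on `U`. -/
def LocalFrame.coframe (F : LocalFrame M) (α : Fin 4) (x : M) : Cotan x :=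
  F.isFrame.coeff α x

namespace LorentzianMetric

/-- The metric at `x` as a bilinear form. -/
def bilin (g : LorentzianMetric M) (x : M) : LinearMap.BilinForm ℝ (Tan x) :=
  LinearMap.mk₂ ℝ (fun v w => g.val x v w) (by simp) (by simp) (by simp) (by simp)

theorem bilin_nondegenerate (g : LorentzianMetric M) (x : M) : (g.bilin x).Nondegenerate := by
  obtain ⟨b, hb⟩ := g.signature x
  refine LinearMap.BilinForm.nondegenerate_of_det_ne_zero (g.bilin x) b ?_
  have h : LinearMap.BilinForm.toMatrix b (g.bilin x) = minkowskiEta := by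
    ext i j
    simp [LinearMap.BilinForm.toMatrix_apply, bilin, hb]
  rw [h, minkowskiEta, Matrix.det_diagonal]
  simp [Fin.prod_univ_four]

/-- The musical isomorphism `T_x M ≃ T*_x M`, `v ↦ g(v, ·)`. -/
def flat (g : LorentzianMetric M) (x : M) : Tan x ≃ₗ[ℝ] Cotan x :=
  (g.bilin x).toDual (g.bilin_nondegenerate x)

/-- The metric of the cotangent bundle, `(a, b) ↦ g(a^♯, b^♯)`. -/
def cometric (g : LorentzianMetric M) (x : M) : LinearMap.BilinForm ℝ (Cotan x) :=
  (g.bilin x).compl₁₂ (g.flat x).symm.toLinearMap (g.flat x).symm.toLinearMap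

/-- The quadratic form `a ↦ a · a` of the cotangent metric. -/
def coquad (g : LorentzianMetric M) (x : M) : QuadraticForm ℝ (Cotan x) :=
  (g.cometric x).toQuadraticMap

/-- The fibre at `x` of the Clifford bundle of differential forms: `a a = a · a`. -/
abbrev Cliff (g : LorentzianMetric M) (x : M) : Type := CliffordAlgebra (g.coquad x)

/-- The exterior product `a ∧ b` of two `1`-forms as an element of the Clifford algebra, through
the linear identification of the exterior algebra with the Clifford algebra. -/
def wedge (g : LorentzianMetric M) (x : M) (a b : Cotan x) : g.Cliff x :=
  (CliffordAlgebra.equivExterior (g.coquad x)).symm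
    (ExteriorAlgebra.ι ℝ a * ExteriorAlgebra.ι ℝ b)

/-- The `1`-form `K = g(𝐊, ·)` associated with a vector field `𝐊`. -/
def lower (g : LorentzianMetric M) (K : Π x : M, Tan x) (x : M) : Cotan x := g.flat x (K x)

/-- `𝐊` is a Killing vector field: it is smooth and its Lie derivative of the metric,
`(£_𝐊 g)(X, Y) = 𝐊(g(X, Y)) - g([𝐊, X], Y) - g(X, [𝐊, Y])`, vanishes on all local smooth vector
fields `X`, `Y`. -/
def IsKilling (g : LorentzianMetric M) (K : Π x : M, Tan x) : Prop :=
  SmoothFieldOn K Set.univ ∧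
  ∀ (U : Set M), IsOpen U → ∀ X Y : Π x : M, Tan x, SmoothFieldOn X U → SmoothFieldOn Y U →
    ∀ x ∈ U,
      mvfderiv (𝓡 4) (fun y => g.val y (X y) (Y y)) x (K x)
        - g.val x (VectorField.mlieBracket (𝓡 4) K X x) (Y x)
        - g.val x (X x) (VectorField.mlieBracket (𝓡 4) K Y x) = 0

/-- `g^{αβ} = θ^α · θ^β`. -/
def gInv (g : LorentzianMetric M) (F : LocalFrame M) (α β : Fin 4) (x : M) : ℝ :=
  g.cometric x (F.coframe α x) (F.coframe β x)

end LorentzianMetric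

namespace Spacetime

/-! ### Hodge star and codifferential on `1`-forms -/

/-- The Hodge dual of a `1`-form: `⋆A = A ⌟ τ_g = τ_g(A^♯, ·, ·, ·)`. -/
def hodgeStar (S : Spacetime M) (A : Π x : M, Cotan x) (x : M) : Form 3 x :=
  let τ : R4 [⋀^Fin 4]→L[ℝ] ℝ := S.vol x
  let v : R4 := (S.flat x).symm (A x)
  τ.curryLeft v

/-- The inverse Hodge dual of a `4`-form: since `⋆1 = τ_g`, it sends `f τ_g` to `f`. The quotient
is evaluated on the standard basis of the model space. -/
def hodgeStarInv (S : Spacetime M) (x : M) (w : Form 4 x) : ℝ :=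
  let b : Fin 4 → Tan x := fun i => (EuclideanSpace.single i 1 : R4)
  w b / S.vol x b

/-- The Hodge codifferential `δA = (-1)^p ⋆⁻¹ d ⋆ A` of a `1`-form (`p = 1`). -/
def codifferential (S : Spacetime M) (A : Π x : M, Cotan x) (x : M) : ℝ :=
  -S.hodgeStarInv x (manifoldExtDeriv (S.hodgeStar A) x)

/-! ### Connection and curvature in a local frame -/

/-- The connection coefficients `L^ρ_{αβ}`: `D_{e_α} e_β = L^ρ_{αβ} e_ρ`, equivalently
`D_{e_α} θ^ρ = -L^ρ_{αβ} θ^β`. -/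
def conn (S : Spacetime M) (F : LocalFrame M) (ρ α β : Fin 4) (x : M) : ℝ :=
  F.coframe ρ x (S.D (F.e β) x (F.e α x))

/-- The covariant derivative `D_{e_α} A` of a `1`-form field `A` on the domain of the frame:
`(D_{e_α} A)(e_β) = e_α(A(e_β)) - A(D_{e_α} e_β)`. -/
def covD (S : Spacetime M) (F : LocalFrame M) (α : Fin 4) (A : Π x : M, Cotan x) (x : M) :
    Cotan x :=
  ∑ β, (mvfderiv (𝓡 4) (fun y => A y (F.e β y)) x (F.e α x)
    - A x (S.D (F.e β) x (F.e α x))) • F.coframe β x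

/-- The curvature `R(X, Y)Z = D_X D_Y Z - D_Y D_X Z - D_{[X, Y]} Z`. -/
def curvature (S : Spacetime M) (X Y Z : Π x : M, Tan x) (x : M) : Tan x :=
  S.D (fun y => S.D Z y (Y y)) x (X x) - S.D (fun y => S.D Z y (X y)) x (Y x)
    - S.D Z x (VectorField.mlieBracket (𝓡 4) X Y x)

/-- The components `R_ν{}^ρ{}_{σμ}` of the Riemann tensor: `R(e_σ, e_μ) e_ν = R_ν{}^ρ{}_{σμ} e_ρ`,
so that `[D_σ, D_μ] K_ν = -R_ν{}^ρ{}_{σμ} K_ρ` for a `1`-form `K`. -/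
def riemann (S : Spacetime M) (F : LocalFrame M) (ν ρ σ μ : Fin 4) (x : M) : ℝ :=
  F.coframe ρ x (S.curvature (F.e σ) (F.e μ) (F.e ν) x)

/-- The components of the Ricci tensor in the convention `R_{νσ} = R_ν{}^μ{}_{σμ}` (contraction of
the second and fourth indices). -/
def ricci (S : Spacetime M) (F : LocalFrame M) (ν σ : Fin 4) (x : M) : ℝ :=
  ∑ μ, S.riemann F ν μ σ μ x

/-- The Ricci `1`-forms `𝓡^μ = R^μ_ν θ^ν`, with `R^μ_ν = g^{μρ} R_{ρν}`. -/
def ricciForm (S : Spacetime M) (F : LocalFrame M) (μ : Fin 4) (x : M) : Cotan x :=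
  ∑ ν, (∑ ρ, S.gInv F μ ρ x * S.ricci F ρ ν x) • F.coframe ν x

/-! ### The Ricci operator and the covariant D'Alembertian on `1`-forms -/

/-- The Ricci operator
`∂∧∂ A = ½ (θ^α ∧ θ^β) ([D_{e_α}, D_{e_β}] - (L^ρ_{αβ} - L^ρ_{βα}) D_{e_ρ}) A`,
the juxtaposition being the Clifford product. -/
def ricciOperator (S : Spacetime M) (F : LocalFrame M) (A : Π x : M, Cotan x) (x : M) :
    S.Cliff x :=
  (1 / 2 : ℝ) • ∑ α, ∑ β, S.wedge x (F.coframe α x) (F.coframe β x) *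
    CliffordAlgebra.ι (S.coquad x)
      (S.covD F α (S.covD F β A) x - S.covD F β (S.covD F α A) x
        - ∑ ρ, (S.conn F ρ α β x - S.conn F ρ β α x) • S.covD F ρ A x)

/-- The covariant D'Alembertian
`□A = ∂·∂ A = g^{αβ} (D_{e_α} D_{e_β} - L^ρ_{αβ} D_{e_ρ}) A`. -/
def dAlembertian (S : Spacetime M) (F : LocalFrame M) (A : Π x : M, Cotan x) (x : M) :
    Cotan x :=
  ∑ α, ∑ β, S.gInv F α β x •
    (S.covD F α (S.covD F β A) x - ∑ ρ, S.conn F ρ α β x • S.covD F ρ A x)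

end Spacetime

end

/-! Curvature part. Because `D` has no torsion, the bracketed operator in `∂∧∂` is `[D_X, D_Y] -
D_{[X,Y]}` on frame fields, so it acts on a 1-form `A` without differentiating it: its components
are `-P_{ναβ}`, where `P_{ναβ} = R_ν{}^ρ{}_{αβ} A_ρ` (`covD_commutator`). The Ricci operator is then
half the sum of `θ^α ∧ θ^β` times `-P_{ναβ} θ^ν` in the Clifford algebra. This product could have a
trivector part, but `P` is antisymmetric in its last two indices and satisfies the first Bianchi
identity, which leaves only a vector (`clifford_triple_contraction`). Metric antisymmetry of the
Riemann tensor identifies that vector as `A_ρ 𝓡^ρ` (`gInv_riemann_contract`). Both formulas for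
`∂∧∂` are instances of `ricciOperator_eq`.

D'Alembertian. For a Killing field the second covariant derivative `H_{αβν}` of `K` is antisymmetric
in `β, ν`. Exchanging `α` and `ν` by the commutator formula gives `H_{αβν} = -H_{ναβ} -
R_β{}^ρ{}_{να} K_ρ`. The trace over `α, β` kills the first term and turns the second into `K_ρ 𝓡^ρ`
(`dAlembertian_killing`).

Codifferential. In a chart, `⋆K` is `ρ` times the contraction of a constant volume form with the
coordinate vector of `K`, so `d⋆K` is the coordinate divergence of `ρK` times that form. If the
coordinate fields are orthonormal at the centre, differentiating `ρ² = -det(g_{ij})` along `K` and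
inserting the Killing equation makes this divergence vanish there (`mvfderiv_volDensity_killing`).
Every point is the centre of its own chart. -/

noncomputable section
-- Smooth functions and fields, and the Lie bracket as a derivation
open Bundle VectorField Filter Topology Set

variable {M : Type*} [TopologicalSpace M] [ChartedSpace R4 M]

/-- A real function that is smooth on `U`. -/
abbrev SmoothFunOn (f : M → ℝ) (U : Set M) : Prop := ContMDiffOn (𝓡 4) 𝓘(ℝ, ℝ) ∞ f U

theorem SmoothFunOn.mdifferentiableAt {f : M → ℝ} {U : Set M} (h : SmoothFunOn f U)
    (hU : IsOpen U) {x : M} (hx : x ∈ U) : MDifferentiableAt (𝓡 4) 𝓘(ℝ, ℝ) f x :=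
  (h.contMDiffAt (hU.mem_nhds hx)).mdifferentiableAt (by simp)

theorem mvfderiv_congr {f g : M → ℝ} {x : M} (h : f =ᶠ[𝓝 x] g) :
    mvfderiv (𝓡 4) f x = mvfderiv (𝓡 4) g x := by
  ext v
  simp only [mvfderiv]
  rw [h.mfderiv_eq]
  rfl

theorem mvfderiv_congr_of_eqOn {f g : M → ℝ} {U : Set M} (hU : IsOpen U) (h : EqOn f g U) {x : M}
    (hx : x ∈ U) : mvfderiv (𝓡 4) f x = mvfderiv (𝓡 4) g x :=
  mvfderiv_congr (eventually_of_mem (hU.mem_nhds hx) h)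

variable [IsManifold (𝓡 4) ∞ M]

theorem minSmoothness_real_le_infty (n : ℕ) : minSmoothness ℝ (n : ℕ∞ω) ≤ ∞ := by
  simpa using (mod_cast le_top : ((n : ℕ∞) : ℕ∞ω) ≤ ((⊤ : ℕ∞) : ℕ∞ω))

instance isManifold_minSmoothness_three : IsManifold (𝓡 4) (minSmoothness ℝ 3) M :=
  IsManifold.of_le (n := ∞) (by exact_mod_cast minSmoothness_real_le_infty 3)

instance isManifold_minSmoothness_two : IsManifold (𝓡 4) (minSmoothness ℝ 2) M :=
  IsManifold.of_le (n := ∞) (by exact_mod_cast minSmoothness_real_le_infty 2)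

instance isManifold_infty_add_one : IsManifold (𝓡 4) ((∞ : ℕ∞ω) + 1) M :=
  inferInstanceAs (IsManifold (𝓡 4) ∞ M)

theorem SmoothFieldOn.contMDiffAt {X : Π x : M, Tan x} {U : Set M} (h : SmoothFieldOn X U)
    (hU : IsOpen U) {x : M} (hx : x ∈ U) : ContMDiffAt (𝓡 4) ((𝓡 4).prod 𝓘(ℝ, R4)) ∞
    (fun y => TotalSpace.mk' R4 (E := (TangentSpace (𝓡 4) : M → Type _)) y (X y)) x :=
  ContMDiffOn.contMDiffAt h (hU.mem_nhds hx)

theorem SmoothFieldOn.mdifferentiableAt {X : Π x : M, Tan x} {U : Set M} (h : SmoothFieldOn X U)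
    (hU : IsOpen U) {x : M} (hx : x ∈ U) : MDifferentiableAt (𝓡 4) ((𝓡 4).prod 𝓘(ℝ, R4))
    (fun y => TotalSpace.mk' R4 (E := (TangentSpace (𝓡 4) : M → Type _)) y (X y)) x :=
  (h.contMDiffAt hU hx).mdifferentiableAt (by simp)

theorem SmoothFieldOn.mlieBracket {X Y : Π x : M, Tan x} {U : Set M} (hU : IsOpen U)
    (hX : SmoothFieldOn X U) (hY : SmoothFieldOn Y U) :
    SmoothFieldOn (VectorField.mlieBracket (𝓡 4) X Y) U := fun x hx =>
  (ContMDiffAt.mlieBracket_vectorField (m := ⊤) (n := ⊤) (hX.contMDiffAt hU hx)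
    (hY.contMDiffAt hU hx) (by simp)).contMDiffWithinAt

theorem SmoothFunOn.smul {f : M → ℝ} {X : Π x : M, Tan x} {U : Set M} (hf : SmoothFunOn f U)
    (hX : SmoothFieldOn X U) : SmoothFieldOn (f • X) U :=
  ContMDiffOn.smul_section hf hX

theorem SmoothFieldOn.sum {ι : Type*} {X : ι → Π x : M, Tan x} {U : Set M} (s : Finset ι)
    (hX : ∀ i ∈ s, SmoothFieldOn (X i) U) : SmoothFieldOn (∑ i ∈ s, X i) U := by
  have := ContMDiffOn.sum_section (s := s) (fun i hi => hX i hi)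
  simpa [SmoothFieldOn, Finset.sum_apply] using! this

theorem SmoothFieldOn.mvfderiv {X : Π x : M, Tan x} {f : M → ℝ} {U : Set M} (hU : IsOpen U)
    (hf : SmoothFunOn f U) (hX : SmoothFieldOn X U) :
    SmoothFunOn (fun x => mvfderiv (𝓡 4) f x (X x)) U := by
  have h1 := ContMDiffOn.contMDiffOn_tangentMapWithin (m := ∞) hf (by simp) hU.uniqueMDiffOn
  have h2 := h1.comp hX (fun x hx => hx)
  have h3 := (contMDiff_snd_tangentBundle_modelSpace ℝ 𝓘(ℝ, ℝ) (n := ∞)).comp_contMDiffOn h2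
  refine h3.congr fun x hx => ?_
  change _root_.mvfderiv (𝓡 4) f x (X x) = mfderivWithin (𝓡 4) 𝓘(ℝ, ℝ) f U x (X x)
  rw [mfderivWithin_of_mem_nhds (hU.mem_nhds hx)]
  rfl

/-- The Jacobi identity for `X`, `Y`, `f • Z`, expanded by the Leibniz rule, differs from `f` times
the Jacobi identity for `X`, `Y`, `Z` by this formula multiplied by `Z`. The auxiliary field `Z` is
there only to be cancelled at `x`, hence `Z x ≠ 0`. -/
theorem mvfderiv_mlieBracket {X Y : Π x : M, Tan x} {f : M → ℝ} {U : Set M} (hU : IsOpen U)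
    (hf : SmoothFunOn f U) (hX : SmoothFieldOn X U) (hY : SmoothFieldOn Y U)
    {Z : Π x : M, Tan x} (hZ : SmoothFieldOn Z U) {x : M} (hx : x ∈ U) (hZx : Z x ≠ 0) :
    mvfderiv (𝓡 4) f x (mlieBracket (𝓡 4) X Y x)
      = mvfderiv (𝓡 4) (fun y => mvfderiv (𝓡 4) f y (Y y)) x (X x)
        - mvfderiv (𝓡 4) (fun y => mvfderiv (𝓡 4) f y (X y)) x (Y x) := by
  have key : ∀ {X Y : Π x : M, Tan x}, SmoothFieldOn X U → SmoothFieldOn Y U →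
      mlieBracket (𝓡 4) X (mlieBracket (𝓡 4) Y (f • Z)) x
        = mvfderiv (𝓡 4) (fun y => mvfderiv (𝓡 4) f y (Y y)) x (X x) • Z x
          + mvfderiv (𝓡 4) f x (Y x) • mlieBracket (𝓡 4) X Z x
          + (mvfderiv (𝓡 4) f x (X x) • mlieBracket (𝓡 4) Y Z x
          + f x • mlieBracket (𝓡 4) X (mlieBracket (𝓡 4) Y Z) x) := by
    intro X Y hX hY
    have e : mlieBracket (𝓡 4) Y (f • Z) =ᶠ[𝓝 x]
        (fun y => mvfderiv (𝓡 4) f y (Y y)) • Z + f • mlieBracket (𝓡 4) Y Z := by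
      filter_upwards [hU.mem_nhds hx] with y hy
      rw [mlieBracket_smul_right (hf.mdifferentiableAt hU hy) (hZ.mdifferentiableAt hU hy)]
      rfl
    have hd := SmoothFieldOn.mvfderiv hU hf hY
    have hb := SmoothFieldOn.mlieBracket hU hY hZ
    rw [EventuallyEq.rfl.mlieBracket_vectorField_eq e,
      mlieBracket_add_right ((hd.smul hZ).mdifferentiableAt hU hx)
        ((hf.smul hb).mdifferentiableAt hU hx),
      mlieBracket_smul_right (hd.mdifferentiableAt hU hx) (hZ.mdifferentiableAt hU hx),
      mlieBracket_smul_right (hf.mdifferentiableAt hU hx) (hb.mdifferentiableAt hU hx)]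
  have two : minSmoothness ℝ 2 ≤ (∞ : ℕ∞ω) := by exact_mod_cast minSmoothness_real_le_infty 2
  have jac := leibniz_identity_mlieBracket_apply ((hX.contMDiffAt hU hx).of_le two)
    ((hY.contMDiffAt hU hx).of_le two) (((hf.smul hZ).contMDiffAt hU hx).of_le two)
  have jac' := leibniz_identity_mlieBracket_apply ((hX.contMDiffAt hU hx).of_le two)
    ((hY.contMDiffAt hU hx).of_le two) ((hZ.contMDiffAt hU hx).of_le two)
  rw [key hX hY, key hY hX, mlieBracket_smul_right (hf.mdifferentiableAt hU hx)
    (hZ.mdifferentiableAt hU hx), jac'] at jac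
  -- The mixed terms in `[X, Z]` and `[Y, Z]` cancel, so what remains is a scalar identity times `Z
  -- x`.
  refine smul_left_injective ℝ hZx ?_
  simp only
  rw [sub_smul]
  have := sub_eq_zero.2 jac
  rw [← sub_eq_zero, ← neg_eq_zero, ← this]
  module

end

/-! ### Local frames, and covariant derivatives of 1-forms -/

noncomputable section
open Bundle VectorField Filter Topology Set

variable {M : Type*} [TopologicalSpace M] [ChartedSpace R4 M]

theorem mdifferentiableAt_sum_fun {ι : Type*} (s : Finset ι) {f : ι → M → ℝ} {x : M}
    (hf : ∀ i ∈ s, MDifferentiableAt (𝓡 4) 𝓘(ℝ, ℝ) (f i) x) :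
    MDifferentiableAt (𝓡 4) 𝓘(ℝ, ℝ) (fun y => ∑ i ∈ s, f i y) x := by
  classical
  induction s using Finset.induction_on with
  | empty => simpa using mdifferentiableAt_const
  | insert a s ha ih =>
    simp only [Finset.sum_insert ha]
    exact (hf a (by simp)).add (ih fun i hi => hf i (by simp [hi]))

theorem mvfderiv_sum {ι : Type*} (s : Finset ι) {f : ι → M → ℝ} {x : M}
    (hf : ∀ i ∈ s, MDifferentiableAt (𝓡 4) 𝓘(ℝ, ℝ) (f i) x) :
    mvfderiv (𝓡 4) (fun y => ∑ i ∈ s, f i y) x = ∑ i ∈ s, mvfderiv (𝓡 4) (f i) x := by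
  classical
  induction s using Finset.induction_on with
  | empty => simpa using mvfderiv_const (0 : ℝ)
  | insert a s ha ih =>
    simp only [Finset.sum_insert ha]
    rw [← ih fun i hi => hf i (by simp [hi])]
    exact mvfderiv_fun_add (hf a (by simp)) (mdifferentiableAt_sum_fun s fun i hi => hf i (by simp [hi]))

theorem smoothFunOn_det {n : Type*} [Fintype n] [DecidableEq n] {A : M → Matrix n n ℝ} {U : Set M}
    (hA : ∀ i j, SmoothFunOn (fun x => A x i j) U) : SmoothFunOn (fun x => (A x).det) U := by
  simp only [Matrix.det_apply']
  refine contMDiffOn_finsetSum fun σ _ => ?_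
  have h : SmoothFunOn (fun x => ∏ i, A x (σ i) i) U := contMDiffOn_finsetProd fun i _ => hA (σ i) i
  exact contMDiffOn_const.mul h

theorem smoothFunOn_inv {n : Type*} [Fintype n] [DecidableEq n] {A : M → Matrix n n ℝ} {U : Set M}
    (hA : ∀ i j, SmoothFunOn (fun x => A x i j) U) (h0 : ∀ x ∈ U, (A x).det ≠ 0) (i j : n) :
    SmoothFunOn (fun x => (A x)⁻¹ i j) U := by
  have h1 : SmoothFunOn (fun x => (A x).det⁻¹ * (A x).adjugate i j) U := by
    refine ContMDiffOn.mul ((smoothFunOn_det hA).inv₀ h0) ?_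
    simp only [Matrix.adjugate_apply]
    refine smoothFunOn_det fun k l => ?_
    simp only [Matrix.updateRow_apply]
    split_ifs
    · exact contMDiffOn_const
    · exact hA k l
  refine h1.congr fun x _ => ?_
  simp [Matrix.inv_def]

variable [IsManifold (𝓡 4) ∞ M]

namespace LorentzianMetric

variable (g : LorentzianMetric M)

theorem smoothFunOn_val {X Y : Π x : M, Tan x} {U : Set M} (hX : SmoothFieldOn X U)
    (hY : SmoothFieldOn Y U) : SmoothFunOn (fun x => g.val x (X x) (Y x)) U := by
  have h := ContMDiffOn.clm_bundle_apply₂ (E₃ := fun _ : M => ℝ) (F₃ := ℝ) (b := fun x : M => x)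
    (g.smooth.contMDiffOn (s := U)) hX hY
  exact fun x hx => (contMDiffWithinAt_totalSpace.1 (h x hx)).2

theorem flat_apply (x : M) (v w : Tan x) : g.flat x v w = g.val x v w := rfl

theorem val_flat_symm (x : M) (a : Cotan x) (v : Tan x) :
    g.val x ((g.flat x).symm a) v = a v := by
  rw [← flat_apply, LinearEquiv.apply_symm_apply]

end LorentzianMetric

namespace LocalFrame

variable (F : LocalFrame M)

theorem coframe_frame {x : M} (hx : x ∈ F.U) (α β : Fin 4) :
    F.coframe α x (F.e β x) = if α = β then 1 else 0 := by
  rw [coframe, F.isFrame.coeff_apply_of_mem hx, ← F.isFrame.toBasisAt_coe hx β,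
    Module.Basis.repr_self, Finsupp.single_apply]
  simp only [eq_comm]

theorem sum_coframe_smul {x : M} (hx : x ∈ F.U) (v : Tan x) :
    ∑ α, F.coframe α x v • F.e α x = v := by
  simpa [coframe, IsLocalFrameOn.coeff, hx] using (Module.Basis.sum_repr (F.isFrame.toBasisAt hx) v)

theorem ext_form {x : M} (hx : x ∈ F.U) {A B : Cotan x} (h : ∀ β, A (F.e β x) = B (F.e β x)) :
    A = B := by
  ext v
  rw [← F.sum_coframe_smul hx v]
  simp [h]

theorem sum_smul_coframe {x : M} (hx : x ∈ F.U) (A : Cotan x) :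
    ∑ α, A (F.e α x) • F.coframe α x = A := by
  refine F.ext_form hx fun β => ?_
  simp [F.coframe_frame hx]

theorem smoothFieldOn_frame (α : Fin 4) : SmoothFieldOn (F.e α) F.U := F.isFrame.contMDiffOn α

/-- The Gram matrix of the frame. -/
def gram (g : LorentzianMetric M) (x : M) : Matrix (Fin 4) (Fin 4) ℝ :=
  Matrix.of fun α β => g.val x (F.e α x) (F.e β x)

theorem det_gram_ne_zero (g : LorentzianMetric M) {x : M} (hx : x ∈ F.U) : (F.gram g x).det ≠ 0 := by
  have h := (LinearMap.BilinForm.nondegenerate_iff_det_ne_zero (B := g.bilin x)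
    (F.isFrame.toBasisAt hx)).1 (g.bilin_nondegenerate x)
  convert h using 2
  ext i j
  simp [gram, LinearMap.BilinForm.toMatrix_apply, LorentzianMetric.bilin]

/-- The components of `X` are recovered from the smooth functions `g(X, e_β)` by the inverse Gram
matrix, whose entries are smooth by Cramer's rule. -/
theorem smoothFunOn_coframe (g : LorentzianMetric M) {X : Π x : M, Tan x}
    (hX : SmoothFieldOn X F.U) (α : Fin 4) : SmoothFunOn (fun x => F.coframe α x (X x)) F.U := by
  have h : SmoothFunOn (fun x => ∑ β, g.val x (X x) (F.e β x) * (F.gram g x)⁻¹ β α) F.U := by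
    refine contMDiffOn_finsetSum fun β _ => ContMDiffOn.mul
      (g.smoothFunOn_val hX (F.smoothFieldOn_frame β)) (smoothFunOn_inv (fun i j => ?_)
        (fun x hx => F.det_gram_ne_zero g hx) β α)
    exact g.smoothFunOn_val (F.smoothFieldOn_frame i) (F.smoothFieldOn_frame j)
  refine h.congr fun x hx => ?_
  have e : (fun β => g.val x (X x) (F.e β x))
      = Matrix.vecMul (fun γ => F.coframe γ x (X x)) (F.gram g x) := by
    ext β
    conv_lhs => rw [← F.sum_coframe_smul hx (X x)]
    simp [Matrix.vecMul, dotProduct, gram]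
  have e2 := congrArg (fun w => Matrix.vecMul w (F.gram g x)⁻¹ α) e
  simp only [Matrix.vecMul_vecMul] at e2
  rw [Matrix.mul_nonsing_inv _ (isUnit_iff_ne_zero.2 (F.det_gram_ne_zero g hx)),
    Matrix.vecMul_one] at e2
  rw [← e2]
  rfl

end LocalFrame

/-- A `1`-form field on `U` whose values on smooth vector fields are smooth. -/
def SmoothFormOn (A : Π x : M, Cotan x) (U : Set M) : Prop :=
  ∀ X : Π x : M, Tan x, SmoothFieldOn X U → SmoothFunOn (fun x => A x (X x)) U

theorem LocalFrame.smoothFormOn_coframe (F : LocalFrame M) (g : LorentzianMetric M) (α : Fin 4) :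
    SmoothFormOn (F.coframe α) F.U :=
  fun _ hX => F.smoothFunOn_coframe g hX α

namespace Spacetime

variable (S : Spacetime M)

theorem smoothFieldOn_D {U : Set M} (hU : IsOpen U) {X Y : Π x : M, Tan x}
    (hX : SmoothFieldOn X U) (hY : SmoothFieldOn Y U) :
    SmoothFieldOn (fun x => S.D Y x (X x)) U := by
  have h := (S.D_smooth U hU).contMDiff (σ := Y) hY
  exact ContMDiffOn.clm_bundle_apply h hX

theorem smoothFormOn_lower {U : Set M} {K : Π x : M, Tan x} (hK : SmoothFieldOn K U) :
    SmoothFormOn (S.lower K) U :=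
  fun _ hX => S.smoothFunOn_val hK hX

theorem D_add {X Y : Π x : M, Tan x} {U : Set M} (hU : IsOpen U) (hX : SmoothFieldOn X U)
    (hY : SmoothFieldOn Y U) {x : M} (hx : x ∈ U) : S.D (X + Y) x = S.D X x + S.D Y x :=
  S.D.isCovariantDerivativeOnUniv.add (hX.mdifferentiableAt hU hx) (hY.mdifferentiableAt hU hx)

theorem D_smul {f : M → ℝ} {X : Π x : M, Tan x} {U : Set M} (hU : IsOpen U) (hf : SmoothFunOn f U)
    (hX : SmoothFieldOn X U) {x : M} (hx : x ∈ U) (v : Tan x) :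
    S.D (f • X) x v = f x • S.D X x v + mvfderiv (𝓡 4) f x v • X x := by
  rw [S.D.isCovariantDerivativeOnUniv.leibniz (hX.mdifferentiableAt hU hx)
    (hf.mdifferentiableAt hU hx)]
  simp

theorem D_sum {ι : Type*} (s : Finset ι) {X : ι → Π x : M, Tan x} {U : Set M} (hU : IsOpen U)
    (hX : ∀ i ∈ s, SmoothFieldOn (X i) U) {x : M} (hx : x ∈ U) (v : Tan x) :
    S.D (∑ i ∈ s, X i) x v = ∑ i ∈ s, S.D (X i) x v := by
  classical
  induction s using Finset.induction_on with
  | empty => simp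
  | insert a s ha ih =>
    rw [Finset.sum_insert ha, Finset.sum_insert ha, ← ih fun i hi => hX i (by simp [hi]),
      S.D_add hU (hX a (by simp)) (SmoothFieldOn.sum s fun i hi => hX i (by simp [hi])) hx]
    rfl

theorem D_congr {X Y : Π x : M, Tan x} {U : Set M} (hU : IsOpen U) (hX : SmoothFieldOn X U)
    (hY : SmoothFieldOn Y U) (h : ∀ x ∈ U, X x = Y x) {x : M} (hx : x ∈ U) :
    S.D X x = S.D Y x :=
  S.D.isCovariantDerivativeOn.congr_of_eqOn (hX.mdifferentiableAt hU hx)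
    (hY.mdifferentiableAt hU hx) (hU.mem_nhds hx) h

theorem D_sub {X Y : Π x : M, Tan x} {U : Set M} (hU : IsOpen U) (hX : SmoothFieldOn X U)
    (hY : SmoothFieldOn Y U) {x : M} (hx : x ∈ U) (v : Tan x) :
    S.D X x v - S.D Y x v = S.D (fun y => X y - Y y) x v := by
  have h1 : SmoothFieldOn (fun y => X y - Y y) U := ContMDiffOn.sub_section hX hY
  rw [sub_eq_iff_eq_add, ← add_apply, ← S.D_add hU h1 hY hx]
  congr 2
  ext y : 1
  simp

theorem D_torsion_free {X Y : Π x : M, Tan x} {U : Set M} (hU : IsOpen U) (hX : SmoothFieldOn X U)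
    (hY : SmoothFieldOn Y U) {x : M} (hx : x ∈ U) :
    mlieBracket (𝓡 4) X Y x = S.D Y x (X x) - S.D X x (Y x) :=
  (S.D.torsion_eq_zero_iff.1 S.D_torsion (hX.mdifferentiableAt hU hx)
    (hY.mdifferentiableAt hU hx)).symm

/-- The directional covariant derivative `(D_{e_α} A)(Z) = e_α(A(Z)) - A(D_{e_α} Z)`. -/
theorem covD_apply (F : LocalFrame M) (α : Fin 4) {A : Π x : M, Cotan x} (hA : SmoothFormOn A F.U)
    {Z : Π x : M, Tan x} (hZ : SmoothFieldOn Z F.U) {x : M} (hx : x ∈ F.U) :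
    S.covD F α A x (Z x) = mvfderiv (𝓡 4) (fun y => A y (Z y)) x (F.e α x)
      - A x (S.D Z x (F.e α x)) := by
  -- With `Z = c^β e_β`, the derivatives of `c^β` enter both terms of the right-hand side and
  -- cancel; what is left is the defining sum of `covD`.
  set c : Fin 4 → M → ℝ := fun β y => F.coframe β y (Z y) with hc
  have hcs : ∀ β, SmoothFunOn (c β) F.U := fun β => F.smoothFunOn_coframe S.toLorentzianMetric hZ β
  have he := F.smoothFieldOn_frame
  have hZe : ∀ y ∈ F.U, Z y = (∑ β, c β • F.e β) y := fun y hy => by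
    simpa using! (F.sum_coframe_smul hy (Z y)).symm
  have h1 : S.D Z x (F.e α x) = ∑ β, (c β x • S.D (F.e β) x (F.e α x)
      + mvfderiv (𝓡 4) (c β) x (F.e α x) • F.e β x) := by
    rw [S.D_congr F.isOpen hZ (SmoothFieldOn.sum _ fun β _ => (hcs β).smul (he β)) hZe hx,
      S.D_sum _ F.isOpen (fun β _ => (hcs β).smul (he β)) hx]
    exact Finset.sum_congr rfl fun β _ => S.D_smul F.isOpen (hcs β) (he β) hx _
  have h2 : mvfderiv (𝓡 4) (fun y => A y (Z y)) x (F.e α x)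
      = ∑ β, (c β x * mvfderiv (𝓡 4) (fun y => A y (F.e β y)) x (F.e α x)
        + A x (F.e β x) * mvfderiv (𝓡 4) (c β) x (F.e α x)) := by
    have e : EqOn (fun y => A y (Z y)) (fun y => ∑ β, c β y * A y (F.e β y)) F.U := fun y hy => by
      simp only [hZe y hy]
      simp
    have hd := fun β => (hcs β).mdifferentiableAt F.isOpen hx
    have hd' := fun β => (hA _ (he β)).mdifferentiableAt F.isOpen hx
    rw [mvfderiv_congr_of_eqOn F.isOpen e hx, mvfderiv_sum (f := fun β y => c β y * A y (F.e β y)) _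
      fun β _ => (hd β).mul (hd' β)]
    simp only [sum_apply]
    refine Finset.sum_congr rfl fun β _ => ?_
    rw [mvfderiv_fun_mul (hd β) (hd' β)]
    simp
  rw [h1, h2]
  simp only [covD, LinearMap.sum_apply, LinearMap.smul_apply, map_sum, map_add, map_smul,
    smul_eq_mul, ← Finset.sum_sub_distrib]
  refine Finset.sum_congr rfl fun β _ => ?_
  simp only [hc]
  ring

/-- This is what allows `covD_apply` to be iterated for second covariant derivatives. -/
theorem smoothFormOn_covD (F : LocalFrame M) (α : Fin 4) {A : Π x : M, Cotan x}
    (hA : SmoothFormOn A F.U) : SmoothFormOn (S.covD F α A) F.U := fun Z hZ =>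
  (ContMDiffOn.sub (SmoothFieldOn.mvfderiv F.isOpen (hA Z hZ) (F.smoothFieldOn_frame α))
    (hA _ (S.smoothFieldOn_D F.isOpen (F.smoothFieldOn_frame α) hZ))).congr
    fun _ hx => S.covD_apply F α hA hZ hx

end Spacetime

end

/-! ### The Riemann tensor and its symmetries -/

noncomputable section
open Bundle VectorField Filter Topology Set

variable {M : Type*} [TopologicalSpace M] [ChartedSpace R4 M]
variable [IsManifold (𝓡 4) ∞ M]

namespace LocalFrame

theorem frame_ne_zero (F : LocalFrame M) {x : M} (hx : x ∈ F.U) (α : Fin 4) : F.e α x ≠ 0 :=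
  (F.isFrame.linearIndependent hx).ne_zero α

end LocalFrame

namespace Spacetime

variable (S : Spacetime M) (F : LocalFrame M)

/-- Vanishing torsion: this is why the connection coefficients in the Ricci operator amount to the
correction `D_{[e_α, e_β]}`. -/
theorem mlieBracket_frame {x : M} (hx : x ∈ F.U) (α β : Fin 4) :
    mlieBracket (𝓡 4) (F.e α) (F.e β) x
      = ∑ ρ, (S.conn F ρ α β x - S.conn F ρ β α x) • F.e ρ x := by
  rw [S.D_torsion_free F.isOpen (F.smoothFieldOn_frame α) (F.smoothFieldOn_frame β) hx]
  simp only [sub_smul, Finset.sum_sub_distrib, conn, F.sum_coframe_smul hx]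

theorem coframe_curvature_sum {x : M} (hx : x ∈ F.U) (A : Cotan x) (ν σ μ : Fin 4) :
    A (S.curvature (F.e σ) (F.e μ) (F.e ν) x) = ∑ ρ, S.riemann F ν ρ σ μ x * A (F.e ρ x) := by
  conv_lhs => rw [← F.sum_coframe_smul hx (S.curvature (F.e σ) (F.e μ) (F.e ν) x)]
  simp [riemann]

/-- The commutator of covariant derivatives acts on a `1`-form as minus the transposed curvature. -/
theorem covD_commutator {A : Π x : M, Cotan x} (hA : SmoothFormOn A F.U) {x : M} (hx : x ∈ F.U)
    (α β ν : Fin 4) :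
    (S.covD F α (S.covD F β A) x - S.covD F β (S.covD F α A) x
      - ∑ ρ, (S.conn F ρ α β x - S.conn F ρ β α x) • S.covD F ρ A x) (F.e ν x)
      = - ∑ ρ, S.riemann F ν ρ α β x * A x (F.e ρ x) := by
  have he := F.smoothFieldOn_frame
  have hO := F.isOpen
  have hD := fun γ δ => S.smoothFieldOn_D hO (he γ) (he δ)
  -- The two terms with a single derivative of `A(D e_ν)` are together symmetric in `α, β`, so they
  -- drop out of the commutator.
  have second : ∀ α β, S.covD F α (S.covD F β A) x (F.e ν x)
      = mvfderiv (𝓡 4) (fun y => mvfderiv (𝓡 4) (fun z => A z (F.e ν z)) y (F.e β y)) x (F.e α x)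
        - mvfderiv (𝓡 4) (fun y => A y (S.D (F.e ν) y (F.e β y))) x (F.e α x)
        - (mvfderiv (𝓡 4) (fun y => A y (S.D (F.e ν) y (F.e α y))) x (F.e β x)
          - A x (S.D (fun y => S.D (F.e ν) y (F.e α y)) x (F.e β x))) := by
    intro α β
    rw [S.covD_apply F α (S.smoothFormOn_covD F β hA) (he ν) hx,
      mvfderiv_congr_of_eqOn hO (fun y hy => S.covD_apply F β hA (he ν) hy) hx,
      S.covD_apply F β hA (hD α ν) hx, mvfderiv_fun_sub
        ((SmoothFieldOn.mvfderiv hO (hA _ (he ν)) (he β)).mdifferentiableAt hO hx)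
        ((hA _ (hD β ν)).mdifferentiableAt hO hx)]
    rfl
  have first : (∑ ρ, (S.conn F ρ α β x - S.conn F ρ β α x) • S.covD F ρ A x) (F.e ν x)
      = mvfderiv (𝓡 4) (fun z => A z (F.e ν z)) x (mlieBracket (𝓡 4) (F.e α) (F.e β) x)
        - A x (S.D (F.e ν) x (mlieBracket (𝓡 4) (F.e α) (F.e β) x)) := by
    rw [S.mlieBracket_frame F hx]
    simp only [LinearMap.sum_apply, LinearMap.smul_apply, map_sum, map_smul,
      S.covD_apply F _ hA (he ν) hx, smul_eq_mul, mul_sub, Finset.sum_sub_distrib]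
  -- The frame vector `e_0` serves as the nonvanishing auxiliary field.
  rw [LinearMap.sub_apply, LinearMap.sub_apply, first, second, second,
    mvfderiv_mlieBracket hO (hA _ (he ν)) (he α) (he β) (he 0) hx (F.frame_ne_zero hx 0),
    ← S.coframe_curvature_sum F hx (A x)]
  simp only [curvature, map_sub]
  ring

theorem curvature_swap (X Y Z : Π x : M, Tan x) (x : M) :
    S.curvature X Y Z x = - S.curvature Y X Z x := by
  simp only [curvature, mlieBracket_swap_apply (V := X), map_neg]
  abel

/-- The first Bianchi identity. -/
theorem curvature_bianchi {U : Set M} (hU : IsOpen U) {X Y Z : Π x : M, Tan x}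
    (hX : SmoothFieldOn X U) (hY : SmoothFieldOn Y U) (hZ : SmoothFieldOn Z U) {x : M} (hx : x ∈ U) :
    S.curvature X Y Z x + S.curvature Y Z X x + S.curvature Z X Y x = 0 := by
  have hD := fun {X Y : Π x : M, Tan x} (hX : SmoothFieldOn X U) (hY : SmoothFieldOn Y U) =>
    S.smoothFieldOn_D hU hX hY
  have hb := fun {X Y : Π x : M, Tan x} (hX : SmoothFieldOn X U) (hY : SmoothFieldOn Y U) =>
    SmoothFieldOn.mlieBracket hU hX hY
  -- Torsion-freeness, used twice, gives `D_X [Y, Z] - D_{[Y, Z]} X = [X, [Y, Z]]`. The cyclic sum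
  -- of the curvatures thus becomes the Jacobi sum.
  have step : ∀ {X Y Z : Π x : M, Tan x}, SmoothFieldOn X U → SmoothFieldOn Y U →
      SmoothFieldOn Z U → S.D (fun y => S.D Z y (Y y)) x (X x) - S.D (fun y => S.D Y y (Z y)) x (X x)
        - S.D X x (mlieBracket (𝓡 4) Y Z x) = mlieBracket (𝓡 4) X (mlieBracket (𝓡 4) Y Z) x := by
    intro X Y Z hX hY hZ
    rw [S.D_torsion_free hU hX (hb hY hZ) hx, S.D_sub hU (hD hY hZ) (hD hZ hY) hx,
      S.D_congr hU (hb hY hZ) (ContMDiffOn.sub_section (hD hY hZ) (hD hZ hY))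
        (fun y hy => S.D_torsion_free hU hY hZ hy) hx]
    rfl
  have two : minSmoothness ℝ 2 ≤ (∞ : ℕ∞ω) := by exact_mod_cast minSmoothness_real_le_infty 2
  have jac := leibniz_identity_mlieBracket_apply ((hX.contMDiffAt hU hx).of_le two)
    ((hY.contMDiffAt hU hx).of_le two) ((hZ.contMDiffAt hU hx).of_le two)
  have s1 := step hX hY hZ
  have s2 := step hY hZ hX
  have s3 := step hZ hX hY
  rw [mlieBracket_swap (V := Z) (W := X)] at s2
  rw [mlieBracket_swap_apply (V := Z)] at s3
  have e : mlieBracket (𝓡 4) Y (-mlieBracket (𝓡 4) X Z) x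
      = - mlieBracket (𝓡 4) Y (mlieBracket (𝓡 4) X Z) x := by
    have := mlieBracket_const_smul_right (c := (-1 : ℝ)) (V := Y)
      ((hb hX hZ).mdifferentiableAt hU hx)
    simpa using! this
  rw [e] at s2
  have tot : (mlieBracket (𝓡 4) X (mlieBracket (𝓡 4) Y Z) x
      + - mlieBracket (𝓡 4) Y (mlieBracket (𝓡 4) X Z) x
      + - mlieBracket (𝓡 4) (mlieBracket (𝓡 4) X Y) Z x) = 0 := by
    rw [jac]; abel
  rw [← s1, ← s2, ← s3] at tot
  rw [← tot]
  simp only [curvature, mlieBracket_swap_apply (V := Z) (W := X), Pi.neg_apply]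
  abel

theorem mvfderiv_val {U : Set M} (hU : IsOpen U) {Y Z : Π x : M, Tan x}
    (hY : SmoothFieldOn Y U) (hZ : SmoothFieldOn Z U) {x : M} (hx : x ∈ U) (v : Tan x) :
    mvfderiv (𝓡 4) (fun y => S.val y (Y y) (Z y)) x v
      = S.val x (S.D Y x v) (Z x) + S.val x (Y x) (S.D Z x v) :=
  S.D_metric x v Y Z (hY.mdifferentiableAt hU hx) (hZ.mdifferentiableAt hU hx)

/-- The operator `XY - YX - [X, Y]` annihilates the function `g(Z, W)`. By metric compatibility it
also yields `g(R(X,Y)Z, W) + g(Z, R(X,Y)W)`, the products of first derivatives being symmetric in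
`X, Y`. The field `V` is the auxiliary one of `mvfderiv_mlieBracket`. -/
theorem val_curvature_antisymm {U : Set M} (hU : IsOpen U) {X Y Z W : Π x : M, Tan x}
    (hX : SmoothFieldOn X U) (hY : SmoothFieldOn Y U) (hZ : SmoothFieldOn Z U)
    (hW : SmoothFieldOn W U) {V : Π x : M, Tan x} (hV : SmoothFieldOn V U) {x : M} (hx : x ∈ U)
    (hVx : V x ≠ 0) :
    S.val x (S.curvature X Y Z x) (W x) = - S.val x (S.curvature X Y W x) (Z x) := by
  have hD := fun {X Y : Π x : M, Tan x} (hX : SmoothFieldOn X U) (hY : SmoothFieldOn Y U) =>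
    S.smoothFieldOn_D hU hX hY
  have hs := fun {X Y : Π x : M, Tan x} (hX : SmoothFieldOn X U) (hY : SmoothFieldOn Y U) =>
    S.smoothFunOn_val hX hY
  have second : ∀ {X Y : Π x : M, Tan x}, SmoothFieldOn X U → SmoothFieldOn Y U →
      mvfderiv (𝓡 4) (fun y => mvfderiv (𝓡 4) (fun z => S.val z (Z z) (W z)) y (Y y)) x (X x)
        = S.val x (S.D (fun y => S.D Z y (Y y)) x (X x)) (W x)
          + S.val x (S.D Z x (Y x)) (S.D W x (X x))
          + (S.val x (S.D Z x (X x)) (S.D W x (Y x))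
          + S.val x (Z x) (S.D (fun y => S.D W y (Y y)) x (X x))) := by
    intro X Y hX hY
    rw [mvfderiv_congr_of_eqOn hU (fun y hy => S.mvfderiv_val hU hZ hW hy (Y y)) hx,
      mvfderiv_fun_add ((hs (hD hY hZ) hW).mdifferentiableAt hU hx)
        ((hs hZ (hD hY hW)).mdifferentiableAt hU hx), add_apply,
      S.mvfderiv_val hU (hD hY hZ) hW hx, S.mvfderiv_val hU hZ (hD hY hW) hx]
  have h := mvfderiv_mlieBracket hU (hs hZ hW) hX hY hV hx hVx
  rw [second hX hY, second hY hX, S.mvfderiv_val hU hZ hW hx] at h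
  rw [S.symm x (S.curvature X Y W x)]
  simp only [curvature, map_sub, sub_apply]
  linarith

theorem riemann_swap (ν ρ σ μ : Fin 4) (x : M) :
    S.riemann F ν ρ σ μ x = - S.riemann F ν ρ μ σ x := by
  rw [riemann, curvature_swap, map_neg, riemann]

theorem riemann_bianchi {x : M} (hx : x ∈ F.U) (ν ρ σ μ : Fin 4) :
    S.riemann F ν ρ σ μ x + S.riemann F σ ρ μ ν x + S.riemann F μ ρ ν σ x = 0 := by
  have he := F.smoothFieldOn_frame
  simp only [riemann, ← map_add]
  rw [S.curvature_bianchi F.isOpen (he σ) (he μ) (he ν) hx, map_zero]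

/-- The antisymmetry of the Riemann tensor in its first pair, with the second index lowered. -/
theorem riemann_lower_antisymm {x : M} (hx : x ∈ F.U) (ν κ σ μ : Fin 4) :
    ∑ ρ, S.riemann F ν ρ σ μ x * F.gram S.toLorentzianMetric x ρ κ
      = - ∑ ρ, S.riemann F κ ρ σ μ x * F.gram S.toLorentzianMetric x ρ ν := by
  have he := F.smoothFieldOn_frame
  have h := S.val_curvature_antisymm F.isOpen (he σ) (he μ) (he ν) (he κ) (he 0) hx
    (F.frame_ne_zero hx 0)
  have l : ∀ ν κ, S.val x (S.curvature (F.e σ) (F.e μ) (F.e ν) x) (F.e κ x)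
      = ∑ ρ, S.riemann F ν ρ σ μ x * F.gram S.toLorentzianMetric x ρ κ := by
    intro ν κ
    have := S.coframe_curvature_sum F hx (S.flat x (F.e κ x)) ν σ μ
    rw [S.flat_apply, S.symm] at this
    rw [this]
    refine Finset.sum_congr rfl fun ρ _ => ?_
    rw [S.flat_apply, S.symm]
    rfl
  rw [← l, ← l, h]

end Spacetime

end

/-! ### Clifford contraction and the Ricci operator -/

noncomputable section
open Bundle VectorField Filter Topology Set

theorem Finset.sum_rotate {ι A : Type*} [Fintype ι] [AddCommMonoid A] (f : ι → ι → ι → A) :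
    ∑ n, ∑ a, ∑ b, f a b n = ∑ n, ∑ a, ∑ b, f n a b := by
  rw [Finset.sum_comm]
  exact Finset.sum_congr rfl fun a _ => Finset.sum_comm

theorem eq_zero_of_eq_neg_real {A : Type*} [AddCommGroup A] [Module ℝ A] {v : A} (h : v = -v) :
    v = 0 := by
  have h2 : (2 : ℝ) • v = 0 := by
    rw [two_smul]
    nth_rewrite 1 [h]
    exact neg_add_cancel v
  exact (smul_eq_zero.1 h2).resolve_left two_ne_zero

/-- The contraction of an antisymmetric array with a symmetric one vanishes. -/
theorem sum_antisymm_mul_symm {ι : Type*} [Fintype ι] {P q : ι → ι → ℝ}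
    (hP : ∀ a b, P a b = - P b a) (hq : ∀ a b, q a b = q b a) : ∑ a, ∑ b, P a b * q a b = 0 := by
  refine eq_zero_of_eq_neg_real ?_
  conv_lhs => rw [Finset.sum_comm]
  simp only [← Finset.sum_neg_distrib]
  refine Finset.sum_congr rfl fun a _ => Finset.sum_congr rfl fun b _ => ?_
  rw [hP b a, hq b a, neg_mul]

/-- In an algebra with Clifford relations, contracting a triple product against a tensor with the
symmetries of the Riemann tensor leaves only the vector part. -/
theorem clifford_triple_contraction {ι A : Type*} [Fintype ι] [Ring A] [Algebra ℝ A]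
    (t : ι → A) (q : ι → ι → ℝ) (hq : ∀ a b, q a b = q b a)
    (ht : ∀ a b, t a * t b + t b * t a = algebraMap ℝ A (2 * q a b))
    (P : ι → ι → ι → ℝ) (hanti : ∀ n a b, P n a b = - P n b a)
    (hcyc : ∀ n a b, P n a b + P a b n + P b n a = 0) :
    ∑ n, ∑ a, ∑ b, P n a b • (t a * t b * t n)
      = (2 : ℝ) • ∑ n, ∑ a, ∑ b, (P n a b * q n b) • t a := by
  set T := ∑ n, ∑ a, ∑ b, P n a b • (t a * t b * t n) with hT
  set V := ∑ n, ∑ a, ∑ b, (P n a b * q n b) • t a with hV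
  have ht' : ∀ a b, t a * t b = (2 * q a b) • (1 : A) - t b * t a := fun a b => by
    rw [← Algebra.algebraMap_eq_smul_one, ← ht, add_sub_cancel_right]
  have hzero : ∑ n, ∑ a, ∑ b, (P n a b * q a b) • t n = 0 := by
    simp only [← Finset.sum_smul, sum_antisymm_mul_symm (hanti _) hq, zero_smul,
      Finset.sum_const_zero]
  have hswap : ∑ n, ∑ a, ∑ b, (P n a b * q n a) • t b = - V := by
    rw [hV]
    conv_lhs => enter [2, n]; rw [Finset.sum_comm]
    simp only [← Finset.sum_neg_distrib]
    refine Finset.sum_congr rfl fun n _ => Finset.sum_congr rfl fun a _ =>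
      Finset.sum_congr rfl fun b _ => ?_
    rw [hanti n b a, neg_mul, neg_smul]
  -- Relabelling gives the coefficient `P n a b` to the monomial `t n * t a * t b`; moving `t n` to
  -- the right end costs two vector terms, each contributing `-2V`.
  have h2 : ∑ n, ∑ a, ∑ b, P a b n • (t a * t b * t n) = T + (-(2 : ℝ) • V + (2 : ℝ) • -V) := by
    rw [Finset.sum_rotate (fun x y z => P x y z • (t x * t y * t z)), ← hswap, hT, hV]
    simp only [Finset.smul_sum, ← Finset.sum_add_distrib]
    refine Finset.sum_congr rfl fun n _ => Finset.sum_congr rfl fun a _ =>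
      Finset.sum_congr rfl fun b _ => ?_
    have e : t n * t a * t b = (2 * q n a) • t b - (2 * q n b) • t a + t a * t b * t n := by
      rw [ht' n a, sub_mul, mul_assoc (t a), ht' n b, mul_sub, mul_assoc]
      simp only [smul_mul_assoc, one_mul, mul_smul_comm, mul_one]
      abel
    rw [e]
    module
  -- Here the monomial is `t b * t n * t a`. One of its two vector terms is contracted with `q a b`
  -- and vanishes by antisymmetry, so it is inserted freely through `e0`.
  have h3 : ∑ n, ∑ a, ∑ b, P b n a • (t a * t b * t n) = T + (2 : ℝ) • -V := by
    have e0 : T + (2 : ℝ) • -V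
        = T + (2 : ℝ) • -V - (2 : ℝ) • ∑ n, ∑ a, ∑ b, (P n a b * q a b) • t n := by
      rw [hzero, smul_zero, sub_zero]
    rw [Finset.sum_rotate (fun x y z => P y z x • (t x * t y * t z)),
      Finset.sum_rotate (fun x y z => P x y z • (t z * t x * t y)), e0, ← hswap, hT]
    simp only [Finset.smul_sum, ← Finset.sum_add_distrib, ← Finset.sum_sub_distrib]
    refine Finset.sum_congr rfl fun n _ => Finset.sum_congr rfl fun a _ =>
      Finset.sum_congr rfl fun b _ => ?_
    have e : t b * t n * t a = (2 * q n a) • t b - (2 * q a b) • t n + t a * t b * t n := by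
      rw [mul_assoc, ht' n a, mul_sub, ← mul_assoc, ht' b a, sub_mul, hq b a]
      simp only [smul_mul_assoc, one_mul, mul_smul_comm, mul_one]
      abel
    rw [e]
    module
  -- The cyclic identity makes the three sums add to zero, that is `3T - 6V = 0`.
  have hsum : T + (T + (-(2 : ℝ) • V + (2 : ℝ) • -V)) + (T + (2 : ℝ) • -V) = 0 := by
    rw [← h2, ← h3, hT]
    simp only [← Finset.sum_add_distrib, ← add_smul, hcyc, zero_smul, Finset.sum_const_zero]
  have h6 : (3 : ℝ) • (T - (2 : ℝ) • V) = 0 := by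
    rw [← hsum]
    module
  exact sub_eq_zero.1 ((smul_eq_zero.1 h6).resolve_left (by norm_num))

/-- The scalar part `q a b` of the product is symmetric and drops out against `P`; the factor `1/2`
cancels the `2` of the triple contraction. This is the shape in which the Ricci operator appears. -/
theorem clifford_bivector_contraction {ι A : Type*} [Fintype ι] [Ring A] [Algebra ℝ A]
    (t : ι → A) (q : ι → ι → ℝ) (hq : ∀ a b, q a b = q b a)
    (ht : ∀ a b, t a * t b + t b * t a = algebraMap ℝ A (2 * q a b))
    (P : ι → ι → ι → ℝ) (hanti : ∀ n a b, P n a b = - P n b a)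
    (hcyc : ∀ n a b, P n a b + P a b n + P b n a = 0) :
    (1 / 2 : ℝ) • ∑ a, ∑ b, (t a * t b - algebraMap ℝ A (q a b)) * ∑ n, (- P n a b) • t n
      = ∑ a, (- ∑ n, ∑ b, P n a b * q n b) • t a := by
  have h1 : ∑ a, ∑ b, (t a * t b - algebraMap ℝ A (q a b)) * ∑ n, (- P n a b) • t n
      = - ∑ n, ∑ a, ∑ b, P n a b • (t a * t b * t n) := by
    have h0 : ∑ n, ∑ a, ∑ b, (P n a b * q a b) • t n = 0 := by
      simp only [← Finset.sum_smul, sum_antisymm_mul_symm (hanti _) hq, zero_smul,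
        Finset.sum_const_zero]
    rw [← sub_zero (∑ n, ∑ a, ∑ b, P n a b • (t a * t b * t n)), ← h0]
    simp only [← Finset.sum_sub_distrib, Finset.mul_sum]
    rw [← Finset.sum_rotate (fun n a b => P n a b • (t a * t b * t n) - (P n a b * q a b) • t n),
      ← Finset.sum_rotate (fun b n a => P n a b • (t a * t b * t n) - (P n a b * q a b) • t n)]
    simp only [← Finset.sum_neg_distrib]
    refine Finset.sum_congr rfl fun a _ => Finset.sum_congr rfl fun b _ =>
      Finset.sum_congr rfl fun n _ => ?_
    rw [sub_mul, ← Algebra.smul_def, mul_smul_comm]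
    module
  rw [h1, clifford_triple_contraction t q hq ht P hanti hcyc, ← smul_neg, smul_smul,
    Finset.sum_comm, ← Finset.sum_neg_distrib]
  norm_num
  refine Finset.sum_congr rfl fun a _ => ?_
  simp only [Finset.sum_smul]

variable {M : Type*} [TopologicalSpace M] [ChartedSpace R4 M]
variable [IsManifold (𝓡 4) ∞ M]

namespace LorentzianMetric

variable (g : LorentzianMetric M)

theorem cometric_comm (x : M) (a b : Cotan x) : g.cometric x a b = g.cometric x b a :=
  g.symm x _ _

/-- The identification of the Clifford and exterior algebras is a change of form by the bilinear
form of `-Q`, that is by `-g`. It sends the Clifford product `ab` to `a ∧ b + g(a, b)`. -/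
theorem wedge_eq (x : M) (a b : Cotan x) :
    g.wedge x a b = CliffordAlgebra.ι (g.coquad x) a * CliffordAlgebra.ι (g.coquad x) b
      - algebraMap ℝ _ (g.cometric x a b) := by
  rw [wedge, LinearEquiv.symm_apply_eq, map_sub]
  simp only [CliffordAlgebra.equivExterior, CliffordAlgebra.changeFormEquiv_apply,
    CliffordAlgebra.changeForm_algebraMap, CliffordAlgebra.changeForm_ι_mul_ι]
  have h : QuadraticMap.associated (R := ℝ) (-(g.coquad x)) a b = - g.cometric x a b := by
    rw [QuadraticMap.associated_apply, coquad]
    simp [g.cometric_comm x b a]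
    ring
  rw [h]
  simp [ExteriorAlgebra.ι]

theorem ι_mul_ι_add_swap (x : M) (a b : Cotan x) :
    CliffordAlgebra.ι (g.coquad x) a * CliffordAlgebra.ι (g.coquad x) b
      + CliffordAlgebra.ι (g.coquad x) b * CliffordAlgebra.ι (g.coquad x) a
      = algebraMap ℝ _ (2 * g.cometric x a b) := by
  have h : QuadraticMap.polar (g.coquad x) a b = 2 * g.cometric x a b := by
    rw [QuadraticMap.polar, coquad]
    simp [g.cometric_comm x b a]
    ring
  rw [CliffordAlgebra.ι_mul_ι_add_swap, h]

theorem gInv_comm (F : LocalFrame M) (α β : Fin 4) (x : M) : g.gInv F α β x = g.gInv F β α x :=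
  g.cometric_comm x _ _

/-- Row `α` of `gInv` lists the components of the vector `(θ^α)^♯`, and `g((θ^α)^♯, e_γ) =
θ^α(e_γ)`. -/
theorem gInv_mul_gram (F : LocalFrame M) {x : M} (hx : x ∈ F.U) :
    Matrix.of (fun α β => g.gInv F α β x) * F.gram g x = 1 := by
  ext α γ
  have h : ∀ β, g.gInv F α β x = F.coframe β x ((g.flat x).symm (F.coframe α x)) := fun β => by
    rw [gInv_comm, ← g.val_flat_symm x (F.coframe β x)]
    rfl
  have e := g.val_flat_symm x (F.coframe α x) (F.e γ x)
  rw [← F.sum_coframe_smul hx ((g.flat x).symm (F.coframe α x)), F.coframe_frame hx] at e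
  simpa [Matrix.mul_apply, Matrix.one_apply, h, LocalFrame.gram] using e

end LorentzianMetric

namespace Spacetime

variable (S : Spacetime M) (F : LocalFrame M)

/-- Antisymmetry of the first index pair with both indices raised: if `R G` is antisymmetric, then
so is `H R = H (R G) H`, where `H = G⁻¹` is symmetric. -/
theorem gInv_riemann {x : M} (hx : x ∈ F.U) (β ρ σ μ : Fin 4) :
    ∑ ν, S.gInv F β ν x * S.riemann F ν ρ σ μ x
      = - ∑ κ, S.gInv F ρ κ x * S.riemann F κ β σ μ x := by
  set G := F.gram S.toLorentzianMetric x with hG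
  set H : Matrix (Fin 4) (Fin 4) ℝ := Matrix.of fun α β => S.gInv F α β x with hH
  set R : Matrix (Fin 4) (Fin 4) ℝ := Matrix.of fun ν ρ => S.riemann F ν ρ σ μ x with hR
  have hHG : H * G = 1 := S.gInv_mul_gram F hx
  have hGH : G * H = 1 := mul_eq_one_comm.1 hHG
  have hGs : G.transpose = G := by
    ext i j
    exact S.symm x _ _
  have hHs : H.transpose = H := by
    ext i j
    exact S.gInv_comm F _ _ x
  have h : R * G = -(G * R.transpose) := by
    rw [← Matrix.transpose_transpose (G * R.transpose), Matrix.transpose_mul,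
      Matrix.transpose_transpose, hGs]
    ext i j
    have := S.riemann_lower_antisymm F hx i j σ μ
    simp only [Matrix.mul_apply, Matrix.neg_apply, Matrix.transpose_apply]
    exact this
  have h2 : H * R = -(H * R).transpose := by
    calc
      H * R = H * (R * G) * H := by simp only [Matrix.mul_assoc, hGH, Matrix.mul_one]
      _ = -(R.transpose * H) := by
        rw [h, Matrix.mul_neg, Matrix.neg_mul, ← Matrix.mul_assoc, hHG, Matrix.one_mul]
      _ = -(H * R).transpose := by rw [Matrix.transpose_mul, hHs]
  have := congrFun (congrFun h2 β) ρ
  simpa only [Matrix.mul_apply, Matrix.neg_apply, Matrix.transpose_apply] using! this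

/-- After the raised pair is exchanged, the sum over `β` contracts the second and fourth indices,
which is the Ricci contraction. Both the Ricci operator and the D'Alembertian end in this sum. -/
theorem gInv_riemann_contract {x : M} (hx : x ∈ F.U) (ρ α : Fin 4) :
    ∑ β, ∑ ν, S.gInv F β ν x * S.riemann F ν ρ α β x
      = - ∑ κ, S.gInv F ρ κ x * S.ricci F κ α x := by
  rw [Finset.sum_congr rfl fun β _ => S.gInv_riemann F hx β ρ α β, Finset.sum_neg_distrib,
    Finset.sum_comm]
  simp only [ricci, Finset.mul_sum]

theorem ricciForm_frame {x : M} (hx : x ∈ F.U) (μ α : Fin 4) :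
    S.ricciForm F μ x (F.e α x) = ∑ κ, S.gInv F μ κ x * S.ricci F κ α x := by
  simp [ricciForm, F.coframe_frame hx]

/-- The Ricci operator is extensorial: `∂∧∂ A = A(e_ρ) 𝓡^ρ`. -/
theorem ricciOperator_eq {A : Π x : M, Cotan x} (hA : SmoothFormOn A F.U) {x : M} (hx : x ∈ F.U) :
    S.ricciOperator F A x
      = CliffordAlgebra.ι (S.coquad x) (∑ ρ, A x (F.e ρ x) • S.ricciForm F ρ x) := by
  set t : Fin 4 → S.Cliff x := fun α => CliffordAlgebra.ι (S.coquad x) (F.coframe α x) with ht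
  set q : Fin 4 → Fin 4 → ℝ := fun α β => S.gInv F α β x with hq
  -- Contracting the upper index with `A` keeps the antisymmetry in `α, β` and the cyclic identity,
  -- the only symmetries the Clifford contraction needs.
  set P : Fin 4 → Fin 4 → Fin 4 → ℝ := fun ν α β => ∑ ρ, S.riemann F ν ρ α β x * A x (F.e ρ x)
    with hP
  have hanti : ∀ n a b, P n a b = - P n b a := fun n a b => by
    simp only [hP, S.riemann_swap F n _ a b x, neg_mul, Finset.sum_neg_distrib]
  have hcyc : ∀ n a b, P n a b + P a b n + P b n a = 0 := fun n a b => by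
    simp only [hP, ← Finset.sum_add_distrib, ← add_mul, S.riemann_bianchi F hx, zero_mul,
      Finset.sum_const_zero]
  have hcomm : ∀ α β, S.covD F α (S.covD F β A) x - S.covD F β (S.covD F α A) x
        - ∑ ρ, (S.conn F ρ α β x - S.conn F ρ β α x) • S.covD F ρ A x
      = ∑ ν, (- P ν α β) • F.coframe ν x := fun α β => by
    rw [← F.sum_smul_coframe hx (_ - _)]
    simp only [S.covD_commutator F hA hx, hP]
  have key := clifford_bivector_contraction t q (fun a b => S.gInv_comm F a b x)
    (fun a b => S.ι_mul_ι_add_swap x _ _) P hanti hcyc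
  have hL : S.ricciOperator F A x = ∑ a, (- ∑ n, ∑ b, P n a b * q n b) • t a := by
    rw [← key, ricciOperator]
    congr 1
    refine Finset.sum_congr rfl fun a _ => Finset.sum_congr rfl fun b _ => ?_
    rw [S.wedge_eq, hcomm, map_sum]
    simp only [map_smul]
    rfl
  rw [hL, ← F.sum_smul_coframe hx (∑ ρ, A x (F.e ρ x) • S.ricciForm F ρ x), map_sum]
  refine Finset.sum_congr rfl fun a _ => ?_
  rw [map_smul]
  congr 1
  simp only [LinearMap.sum_apply, LinearMap.smul_apply, S.ricciForm_frame F hx, smul_eq_mul]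
  -- The nested terms solve `gInv_riemann_contract` for the Ricci sum on its right-hand side.
  rw [Finset.sum_congr rfl fun ρ _ => congrArg (A x (F.e ρ x) * ·)
    (eq_neg_iff_add_eq_zero.2 ((add_comm _ _).trans
      (eq_neg_iff_add_eq_zero.1 (S.gInv_riemann_contract F hx ρ a))))]
  simp only [mul_neg, Finset.sum_neg_distrib, hP, hq, Finset.sum_mul, Finset.mul_sum]
  rw [← Finset.sum_rotate (fun n b ρ => S.riemann F n ρ a b x * A x (F.e ρ x) * S.gInv F n b x)]
  refine congrArg Neg.neg (Finset.sum_congr rfl fun ρ _ => ?_)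
  rw [Finset.sum_comm]
  refine Finset.sum_congr rfl fun b _ => Finset.sum_congr rfl fun n _ => ?_
  rw [S.gInv_comm F n b]
  ring

/-! ### Second derivatives of a Killing form -/

/-- The Killing equation `(D_β K)_ν + (D_ν K)_β = 0`. -/
theorem covD_lower_killing {K : Π x : M, Tan x} (hK : S.IsKilling K) {x : M} (hx : x ∈ F.U)
    (β ν : Fin 4) :
    S.covD F β (S.lower K) x (F.e ν x) = - S.covD F ν (S.lower K) x (F.e β x) := by
  have hKU : SmoothFieldOn K F.U := ContMDiffOn.mono hK.1 (subset_univ _)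
  have he := F.smoothFieldOn_frame
  have hcov : ∀ β ν, S.covD F β (S.lower K) x (F.e ν x) = S.val x (S.D K x (F.e β x)) (F.e ν x) := by
    intro β ν
    rw [S.covD_apply F β (S.smoothFormOn_lower hKU) (he ν) hx]
    have := S.mvfderiv_val F.isOpen hKU (he ν) hx (F.e β x)
    simp only [LorentzianMetric.lower, LorentzianMetric.flat_apply]
    rw [this, add_sub_cancel_right]
  have h := hK.2 F.U F.isOpen _ _ (he β) (he ν) x hx
  rw [S.mvfderiv_val F.isOpen (he β) (he ν) hx, S.D_torsion_free F.isOpen hKU (he β) hx,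
    S.D_torsion_free F.isOpen hKU (he ν) hx] at h
  simp only [map_sub, sub_apply] at h
  rw [hcov, hcov, S.symm x (S.D K x (F.e ν x))]
  linarith

theorem D_frame {x : M} (hx : x ∈ F.U) (α β : Fin 4) :
    S.D (F.e β) x (F.e α x) = ∑ ρ, S.conn F ρ α β x • F.e ρ x :=
  (F.sum_coframe_smul hx _).symm

/-- The Killing equation holds throughout `U`, so it may be differentiated along `e_α`. The two
connection corrections are exchanged, with a change of sign, by the same equation. -/
theorem hessian_killing_antisymm {K : Π x : M, Tan x} (hK : S.IsKilling K) {x : M} (hx : x ∈ F.U)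
    (α β ν : Fin 4) :
    (S.covD F α (S.covD F β (S.lower K)) x - ∑ ρ, S.conn F ρ α β x • S.covD F ρ (S.lower K) x)
        (F.e ν x)
      = -(S.covD F α (S.covD F ν (S.lower K)) x
          - ∑ ρ, S.conn F ρ α ν x • S.covD F ρ (S.lower K) x) (F.e β x) := by
  have hKU : SmoothFormOn (S.lower K) F.U :=
    S.smoothFormOn_lower (ContMDiffOn.mono hK.1 (subset_univ _))
  have he := F.smoothFieldOn_frame
  have h : ∀ β ν, (S.covD F α (S.covD F β (S.lower K)) x
        - ∑ ρ, S.conn F ρ α β x • S.covD F ρ (S.lower K) x) (F.e ν x)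
      = mvfderiv (𝓡 4) (fun y => S.covD F β (S.lower K) y (F.e ν y)) x (F.e α x)
        - ∑ ρ, S.conn F ρ α ν x * S.covD F β (S.lower K) x (F.e ρ x)
        - ∑ ρ, S.conn F ρ α β x * S.covD F ρ (S.lower K) x (F.e ν x) := by
    intro β ν
    rw [LinearMap.sub_apply, S.covD_apply F α (S.smoothFormOn_covD F β hKU) (he ν) hx,
      S.D_frame F hx]
    simp
  rw [h, h, mvfderiv_congr_of_eqOn F.isOpen
    (fun y hy => S.covD_lower_killing F hK hy β ν) hx, mvfderiv_fun_neg]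
  simp only [S.covD_lower_killing F hK hx β, fun ρ => S.covD_lower_killing F hK hx ρ ν, mul_neg,
    Finset.sum_neg_distrib, neg_apply]
  ring

/-- Antisymmetry in the last two indices followed by one commutator moves the free index `ν` to the
front of the second derivative, where the trace over the other two vanishes; only curvature remains.
-/
theorem dAlembertian_killing {K : Π x : M, Tan x} (hK : S.IsKilling K) {x : M} (hx : x ∈ F.U) :
    S.dAlembertian F (S.lower K) x = ∑ α, S.lower K x (F.e α x) • S.ricciForm F α x := by
  have hKU : SmoothFormOn (S.lower K) F.U :=
    S.smoothFormOn_lower (ContMDiffOn.mono hK.1 (subset_univ _))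
  refine F.ext_form hx fun ν => ?_
  set H : Fin 4 → Fin 4 → Fin 4 → ℝ := fun α β ν => (S.covD F α (S.covD F β (S.lower K)) x
    - ∑ ρ, S.conn F ρ α β x • S.covD F ρ (S.lower K) x) (F.e ν x) with hH
  set k : Fin 4 → ℝ := fun ρ => S.lower K x (F.e ρ x) with hk
  have hanti : ∀ α β ν, H α β ν = - H α ν β := fun α β ν => S.hessian_killing_antisymm F hK hx α β ν
  have hcomm : ∀ α β ν, H α β ν - H β α ν = - ∑ ρ, S.riemann F ν ρ α β x * k ρ := by
    intro α β ν
    rw [← S.covD_commutator F hKU hx α β ν]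
    simp only [hH, LinearMap.sub_apply, LinearMap.sum_apply, LinearMap.smul_apply, smul_eq_mul,
      sub_mul, Finset.sum_sub_distrib]
    ring
  have h0 : ∑ α, ∑ β, S.gInv F α β x * H ν α β = 0 := by
    simp only [mul_comm (S.gInv F _ _ x)]
    exact sum_antisymm_mul_symm (hanti ν) fun a b => S.gInv_comm F a b x
  have hL : S.dAlembertian F (S.lower K) x (F.e ν x) = ∑ α, ∑ β, S.gInv F α β x * H α β ν := by
    simp only [dAlembertian, LinearMap.sum_apply, LinearMap.smul_apply, smul_eq_mul, hH]
  have e : ∀ α β, H α β ν = - H ν α β - ∑ ρ, S.riemann F β ρ ν α x * k ρ := by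
    intro α β
    linarith [hanti α β ν, hcomm ν α β]
  rw [hL]
  simp only [e, mul_sub, mul_neg, Finset.sum_sub_distrib, Finset.sum_neg_distrib, h0,
    LinearMap.sum_apply, LinearMap.smul_apply, S.ricciForm_frame F hx, smul_eq_mul]
  rw [Finset.sum_congr rfl fun ρ _ => congrArg (S.lower K x (F.e ρ x) * ·)
    (eq_neg_iff_add_eq_zero.2 ((add_comm _ _).trans
      (eq_neg_iff_add_eq_zero.1 (S.gInv_riemann_contract F hx ρ ν))))]
  simp only [mul_neg, Finset.sum_neg_distrib, neg_zero, zero_sub, Finset.mul_sum, neg_inj]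
  rw [← Finset.sum_rotate (fun α β ρ => S.gInv F α β x * (S.riemann F β ρ ν α x * k ρ))]
  refine Finset.sum_congr rfl fun ρ _ => Finset.sum_congr rfl fun b _ =>
    Finset.sum_congr rfl fun n _ => ?_
  ring

end Spacetime

end

/-! ### Determinants and the volume form -/

noncomputable section
open Bundle VectorField Filter Topology Set

/-- Replacing the `i`-th vector of a basis in a top form multiplies it by the `i`-th coordinate. -/
theorem AlternatingMap.map_vecCons_removeNth {n : ℕ} {V : Type*} [AddCommGroup V] [Module ℝ V]
    (f : V [⋀^Fin (n + 1)]→ₗ[ℝ] ℝ) (b : Module.Basis (Fin (n + 1)) ℝ V) (i : Fin (n + 1)) (v : V) :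
    f (Matrix.vecCons v (i.removeNth b)) = (-1) ^ (i : ℕ) * (b.repr v i * f b) := by
  rw [← f.neg_one_pow_smul_map_insertNth i v (i.removeNth b), Fin.insertNth_removeNth, zsmul_eq_mul]
  push_cast
  congr 1
  conv_lhs => rw [← b.sum_repr v]
  have h := f.map_update_sum Finset.univ i (fun j => b.repr v j • b j) (b : Fin (n + 1) → V)
  simp only [f.map_update_smul, smul_eq_mul] at h
  rw [h, Finset.sum_eq_single i]
  · rw [Function.update_eq_self]
  · intro j _ hj
    rw [f.map_update_self _ hj.symm, mul_zero]
  · simp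

variable {M : Type*} [TopologicalSpace M] [ChartedSpace R4 M]

theorem mdifferentiableAt_prod_fun {ι : Type*} (s : Finset ι) {f : ι → M → ℝ} {x : M}
    (hf : ∀ i ∈ s, MDifferentiableAt (𝓡 4) 𝓘(ℝ, ℝ) (f i) x) :
    MDifferentiableAt (𝓡 4) 𝓘(ℝ, ℝ) (fun y => ∏ i ∈ s, f i y) x := by
  classical
  induction s using Finset.induction_on with
  | empty => simpa using mdifferentiableAt_const
  | insert a s ha ih =>
    simp only [Finset.prod_insert ha]
    exact (hf a (by simp)).mul (ih fun i hi => hf i (by simp [hi]))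

theorem mvfderiv_prod {ι : Type*} [DecidableEq ι] (s : Finset ι) {f : ι → M → ℝ} {x : M}
    (hf : ∀ i ∈ s, MDifferentiableAt (𝓡 4) 𝓘(ℝ, ℝ) (f i) x) :
    mvfderiv (𝓡 4) (fun y => ∏ i ∈ s, f i y) x
      = ∑ i ∈ s, (∏ j ∈ s.erase i, f j x) • mvfderiv (𝓡 4) (f i) x := by
  induction s using Finset.induction_on with
  | empty => simpa using mvfderiv_const (1 : ℝ)
  | insert a s ha ih =>
    have hs := fun i hi => hf i (Finset.mem_insert_of_mem hi)
    simp only [Finset.prod_insert ha, Finset.sum_insert ha]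
    rw [mvfderiv_fun_mul (hf a (by simp)) (mdifferentiableAt_prod_fun s hs), ih hs, add_comm,
      Finset.smul_sum, Finset.erase_insert ha]
    congr 1
    refine Finset.sum_congr rfl fun i hi => ?_
    have hai : a ≠ i := fun h => ha (h ▸ hi)
    rw [Finset.erase_insert_of_ne hai, Finset.prod_insert (by simp [ha]), mul_smul]

/-- The derivative of a determinant at a diagonal matrix. -/
theorem mvfderiv_det_of_diagonal {n : Type*} [Fintype n] [DecidableEq n] {A : M → Matrix n n ℝ}
    {x : M} (hA : ∀ i j, MDifferentiableAt (𝓡 4) 𝓘(ℝ, ℝ) (fun y => A y i j) x) {d : n → ℝ}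
    (hd : A x = Matrix.diagonal d) :
    mvfderiv (𝓡 4) (fun y => (A y).det) x
      = ∑ i, (∏ j ∈ Finset.univ.erase i, d j) • mvfderiv (𝓡 4) (fun y => A y i i) x := by
  simp only [Matrix.det_apply']
  have hp : ∀ σ : Equiv.Perm n,
      MDifferentiableAt (𝓡 4) 𝓘(ℝ, ℝ) (fun y => ∏ i, A y (σ i) i) x :=
    fun σ => mdifferentiableAt_prod_fun _ fun i _ => hA (σ i) i
  rw [mvfderiv_sum (f := fun (σ : Equiv.Perm n) y => (Equiv.Perm.sign σ : ℝ) * ∏ i, A y (σ i) i) _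
      fun σ _ => mdifferentiableAt_const.mul (hp σ),
    Finset.sum_eq_single 1]
  · simp only [Equiv.Perm.sign_one, Units.val_one, Int.cast_one, one_mul, Equiv.Perm.one_apply]
    rw [mvfderiv_prod _ fun i _ => hA i i, hd]
    simp
  · intro σ _ hσ
    rw [mvfderiv_fun_mul mdifferentiableAt_const (hp σ), mvfderiv_const, smul_zero, add_zero,
      mvfderiv_prod _ fun i _ => hA (σ i) i, Finset.sum_eq_zero, smul_zero]
    intro i _
    -- A nontrivial permutation moves at least two points, so an off-diagonal factor, zero at `x`,
    -- survives the removal of the `i`-th one.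
    obtain ⟨j, hji, hj⟩ : ∃ j, j ≠ i ∧ σ j ≠ j := by
      by_contra! h
      refine hσ (Equiv.ext fun j => ?_)
      by_cases hj : j = i
      · subst hj
        by_contra hne
        exact hne (σ.injective (h _ hne))
      · exact h j hj
    rw [Finset.prod_eq_zero (i := j) (by simp [hji]) (by rw [hd, Matrix.diagonal_apply_ne _ hj]),
      zero_smul]
  · simp

variable [IsManifold (𝓡 4) ∞ M]

/-- The Gram matrix of `v` is `Pᵀ η P` with `P` its coordinate matrix in an orthonormal basis, and
`det η = -1`. Squaring makes the orientation sign of `vol` irrelevant. -/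
theorem Spacetime.vol_sq (S : Spacetime M) (x : M) (v : Fin 4 → Tan x) :
    S.vol x v ^ 2 = - (Matrix.of fun i j => S.val x (v i) (v j)).det := by
  obtain ⟨o, ho⟩ := S.signature x
  have h1 := S.vol_orthonormal x o ho
  have h2 : S.vol x v = o.det v * S.vol x o := by
    have := congrArg (fun f => f v) ((S.vol x).toAlternatingMap.eq_smul_basis_det o)
    simpa [mul_comm] using! this
  have h3 : (Matrix.of fun i j => S.val x (v i) (v j))
      = (o.toMatrix v).transpose * minkowskiEta * o.toMatrix v := by
    ext i j
    have e : ∀ i, v i = ∑ k, o.toMatrix v k i • o k := fun i => (o.sum_repr (v i)).symm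
    simp only [Matrix.of_apply, Matrix.mul_apply, Matrix.transpose_apply, Finset.sum_mul]
    rw [e i, e j]
    simp only [map_sum, map_smul, sum_apply, smul_apply, ho, smul_eq_mul, Finset.mul_sum]
    refine Finset.sum_congr rfl fun k _ => Finset.sum_congr rfl fun l _ => ?_
    ring
  have h4 : minkowskiEta.det = -1 := by
    simp [minkowskiEta, Matrix.det_diagonal, Fin.prod_univ_four]
  rw [h2, h3, Matrix.det_mul, Matrix.det_mul, Matrix.det_transpose, h4, mul_pow, ← sq_abs (S.vol x o),
    h1, Module.Basis.det_apply]
  ring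

end

/-! ### Coordinate vector fields and chart representatives -/

noncomputable section
open Bundle VectorField Filter Topology Set

variable {M : Type*} [TopologicalSpace M] [ChartedSpace R4 M]

/-- The vector field on the chart domain at `x₀` with constant coordinates `v`. -/
def coordField (x₀ : M) (v : R4) : Π x : M, Tan x :=
  mpullback (𝓡 4) 𝓘(ℝ, R4) (extChartAt (𝓡 4) x₀) (fun _ => v)

/-- The representation of a vector field in the chart at `x₀`. -/
def chartRep (x₀ : M) (K : Π x : M, Tan x) : R4 → R4 :=
  mpullbackWithin 𝓘(ℝ, R4) (𝓡 4) (extChartAt (𝓡 4) x₀).symm K (range (𝓡 4))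

theorem coordField_sum_smul {ι : Type*} (s : Finset ι) (x₀ : M) (c : ι → ℝ) (v : ι → R4) (x : M) :
    coordField x₀ (∑ i ∈ s, c i • v i) x = ∑ i ∈ s, c i • coordField x₀ (v i) x :=
  (map_sum (mfderiv (𝓡 4) 𝓘(ℝ, R4) (extChartAt (𝓡 4) x₀) x).inverse (fun i => c i • v i) s).trans
    (Finset.sum_congr rfl fun i _ =>
      map_smul (mfderiv (𝓡 4) 𝓘(ℝ, R4) (extChartAt (𝓡 4) x₀) x).inverse (c i) (v i))

theorem mfderivWithin_range_model {y : R4} (f : R4 → M) :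
    mfderivWithin 𝓘(ℝ, R4) (𝓡 4) f (range (𝓡 4)) y = mfderiv 𝓘(ℝ, R4) (𝓡 4) f y := by
  rw [ModelWithCorners.range_eq_univ, mfderivWithin_univ]

variable [IsManifold (𝓡 4) ∞ M]

theorem coordField_symm (x₀ : M) (v : R4) {y : R4} (hy : y ∈ (extChartAt (𝓡 4) x₀).target) :
    coordField x₀ v ((extChartAt (𝓡 4) x₀).symm y)
      = mfderiv 𝓘(ℝ, R4) (𝓡 4) (extChartAt (𝓡 4) x₀).symm y v := by
  have h1 := mfderiv_extChartAt_comp_mfderivWithin_extChartAt_symm (I := 𝓡 4) hy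
  have h2 := mfderivWithin_extChartAt_symm_comp_mfderiv_extChartAt (I := 𝓡 4) hy
  have h := ContinuousLinearMap.inverse_eq h1 h2
  rw [mfderivWithin_range_model] at h
  exact congrArg (fun L => L v) h

theorem smoothFieldOn_coordField (x₀ : M) (v : R4) :
    SmoothFieldOn (coordField x₀ v) (extChartAt (𝓡 4) x₀).source := fun x hx => by
  refine ContMDiffAt.contMDiffWithinAt (ContMDiffAt.mpullback_vectorField_preimage (n := ∞) ?_
    (contMDiffAt_extChartAt' (by simpa using hx)) (isInvertible_mfderiv_extChartAt hx) (by simp))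
  exact contMDiffWithinAt_vectorSpace_iff_contDiffWithinAt.2 contDiffWithinAt_const

theorem mfderiv_chartRep (x₀ : M) (K : Π x : M, Tan x) {y : R4}
    (hy : y ∈ (extChartAt (𝓡 4) x₀).target) :
    mfderiv 𝓘(ℝ, R4) (𝓡 4) (extChartAt (𝓡 4) x₀).symm y (chartRep x₀ K y)
      = K ((extChartAt (𝓡 4) x₀).symm y) := by
  have h := isInvertible_mfderivWithin_extChartAt_symm (I := 𝓡 4) hy
  rw [← mfderivWithin_range_model]
  exact h.self_apply_inverse _

theorem chartRep_coordField (x₀ : M) (v : R4) {y : R4} (hy : y ∈ (extChartAt (𝓡 4) x₀).target) :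
    chartRep x₀ (coordField x₀ v) y = v := by
  have h := isInvertible_mfderivWithin_extChartAt_symm (I := 𝓡 4) hy
  rw [chartRep, mpullbackWithin_apply, coordField_symm x₀ v hy, ← mfderivWithin_range_model]
  exact h.inverse_apply_self _

theorem differentiableAt_chartRep (x₀ : M) {K : Π x : M, Tan x} (hK : SmoothFieldOn K univ) :
    DifferentiableAt ℝ (chartRep x₀ K) (extChartAt (𝓡 4) x₀ x₀) := by
  have h := MDifferentiableWithinAt.differentiableWithinAt_mpullbackWithin_vectorField (s := univ)
    (hK.mdifferentiableAt isOpen_univ (mem_univ x₀)).mdifferentiableWithinAt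
  exact h.differentiableAt (by simp)

/-- In the chart the second field is constant, so only the term differentiating `K` along `v`
survives. -/
theorem mlieBracket_coordField (x₀ : M) (K : Π x : M, Tan x) (v : R4) :
    mlieBracket (𝓡 4) K (coordField x₀ v) x₀
      = - coordField x₀ (fderiv ℝ (chartRep x₀ K) (extChartAt (𝓡 4) x₀ x₀) v) x₀ := by
  have h : lieBracketWithin ℝ (chartRep x₀ K) (chartRep x₀ (coordField x₀ v)) univ
      (extChartAt (𝓡 4) x₀ x₀) = - fderiv ℝ (chartRep x₀ K) (extChartAt (𝓡 4) x₀ x₀) v := by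
    have e : chartRep x₀ (coordField x₀ v) =ᶠ[𝓝 (extChartAt (𝓡 4) x₀ x₀)] fun _ => v :=
      eventually_of_mem (extChartAt_target_mem_nhds x₀) fun y hy => chartRep_coordField x₀ v hy
    simp only [lieBracketWithin, fderivWithin_univ]
    rw [e.fderiv_eq, e.self_of_nhds]
    simp
  rw [mlieBracket, mlieBracketWithin_apply]
  simp only [preimage_univ, univ_inter, ModelWithCorners.range_eq_univ] at h ⊢
  have h' : lieBracketWithin ℝ (mpullbackWithin 𝓘(ℝ, R4) (𝓡 4) (extChartAt (𝓡 4) x₀).symm K univ)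
      (mpullbackWithin 𝓘(ℝ, R4) (𝓡 4) (extChartAt (𝓡 4) x₀).symm (coordField x₀ v) univ) univ
      (extChartAt (𝓡 4) x₀ x₀) = - fderiv ℝ (chartRep x₀ K) (extChartAt (𝓡 4) x₀ x₀) v := by
    rw [← h]
    simp only [chartRep, ModelWithCorners.range_eq_univ]
  refine (congrArg _ h').trans ?_
  exact map_neg (mfderiv (𝓡 4) 𝓘(ℝ, R4) (extChartAt (𝓡 4) x₀) x₀).inverse _

end

/-! ### Vanishing codifferential of a Killing form -/

noncomputable section
open Bundle VectorField Filter Topology Set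

variable {M : Type*} [TopologicalSpace M] [ChartedSpace R4 M] [IsManifold (𝓡 4) ∞ M]

/-- Every basis of a tangent space consists of the values of constant coordinate fields. -/
theorem exists_basis_coordField (x₀ : M) (o : Module.Basis (Fin 4) ℝ (Tan x₀)) :
    ∃ b : Module.Basis (Fin 4) ℝ R4, ∀ i, coordField x₀ (b i) x₀ = o i := by
  obtain ⟨e, he⟩ := isInvertible_mfderiv_extChartAt (I := 𝓡 4) (mem_extChartAt_source (I := 𝓡 4) x₀)
  refine ⟨o.map e.toLinearEquiv, fun i => ?_⟩
  have h : coordField x₀ (e (o i)) x₀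
      = (mfderiv (𝓡 4) 𝓘(ℝ, R4) (extChartAt (𝓡 4) x₀) x₀).inverse (e (o i)) := rfl
  rw [← he, ContinuousLinearMap.inverse_equiv] at h
  exact h.trans (e.symm_apply_apply (o i))

namespace Spacetime

variable (S : Spacetime M)

/-- The component of the volume form in coordinates. -/
def volDensity (x₀ : M) (b : Fin 4 → R4) (x : M) : ℝ := S.vol x fun i => coordField x₀ (b i) x

theorem smoothFunOn_volDensity (x₀ : M) (b : Fin 4 → R4) :
    SmoothFunOn (S.volDensity x₀ b) (extChartAt (𝓡 4) x₀).source :=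
  S.vol_smooth _ (isOpen_extChartAt_source x₀) _ fun i => smoothFieldOn_coordField x₀ (b i)

/-- A Killing field is divergence free: `K(ρ) + ρ ∂_i K^i = 0` at the centre of a chart whose
coordinate fields are orthonormal there. -/
theorem mvfderiv_volDensity_killing {K : Π x : M, Tan x} (hK : S.IsKilling K) (x₀ : M)
    (b : Module.Basis (Fin 4) ℝ R4)
    (hb : ∀ i j, S.val x₀ (coordField x₀ (b i) x₀) (coordField x₀ (b j) x₀) = minkowskiEta i j) :
    mvfderiv (𝓡 4) (S.volDensity x₀ b) x₀ (K x₀) + S.volDensity x₀ b x₀ *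
      ∑ i, b.repr (fderiv ℝ (chartRep x₀ K) (extChartAt (𝓡 4) x₀ x₀) (b i)) i = 0 := by
  set U := (extChartAt (𝓡 4) x₀).source
  have hU : IsOpen U := isOpen_extChartAt_source x₀
  have hx : x₀ ∈ U := mem_extChartAt_source x₀
  set X : Fin 4 → Π x : M, Tan x := fun i => coordField x₀ (b i) with hX
  have hXs : ∀ i, SmoothFieldOn (X i) U := fun i => smoothFieldOn_coordField x₀ (b i)
  set c : Fin 4 → Fin 4 → ℝ := fun i j =>
    b.repr (fderiv ℝ (chartRep x₀ K) (extChartAt (𝓡 4) x₀ x₀) (b i)) j with hc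
  have hbr : ∀ i, mlieBracket (𝓡 4) K (X i) x₀ = - ∑ j, c i j • X j x₀ := fun i => by
    rw [hX, mlieBracket_coordField, ← coordField_sum_smul]
    simp only [hc, b.sum_repr]
  -- Only diagonal metric coefficients are needed: the derivative of a determinant at a diagonal
  -- matrix does not see the others.
  have hkill : ∀ i, mvfderiv (𝓡 4) (fun y => S.val y (X i y) (X i y)) x₀ (K x₀)
      = - (2 * (c i i * minkowskiEta i i)) := fun i => by
    have h := hK.2 U hU _ _ (hXs i) (hXs i) x₀ hx
    have e : S.val x₀ (X i x₀) (∑ j, c i j • X j x₀) = c i i * minkowskiEta i i := by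
      simp only [map_sum, map_smul, hX, hb, smul_eq_mul]
      rw [Finset.sum_eq_single i]
      · intro j _ hj
        simp [minkowskiEta, hj.symm]
      · simp
    rw [hbr, S.symm x₀ (- _), map_neg, e] at h
    linarith
  set G : M → Matrix (Fin 4) (Fin 4) ℝ := fun y => Matrix.of fun i j => S.val y (X i y) (X j y)
  have hdet := mvfderiv_det_of_diagonal (A := G) (x := x₀) (d := ![1, -1, -1, -1])
    (fun i j => (S.smoothFunOn_val (hXs i) (hXs j)).mdifferentiableAt hU hx)
    (by ext i j; exact hb i j)
  have hsq : (fun y => S.volDensity x₀ b y * S.volDensity x₀ b y) = fun y => - (G y).det := by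
    ext y
    rw [← pow_two]
    exact S.vol_sq y _
  have hρ := (S.smoothFunOn_volDensity x₀ b).mdifferentiableAt hU hx
  have hd := congrArg (fun f => mvfderiv (𝓡 4) f x₀ (K x₀)) hsq
  simp only [mvfderiv_fun_neg] at hd
  rw [mvfderiv_fun_mul hρ hρ, hdet] at hd
  have hone : S.volDensity x₀ b x₀ * S.volDensity x₀ b x₀ = 1 := by
    have h := congrFun hsq x₀
    have hG : G x₀ = minkowskiEta := by ext i j; exact hb i j
    simpa [hG, minkowskiEta, Matrix.det_diagonal, Fin.prod_univ_four] using h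
  have hG : ∀ i, mvfderiv (𝓡 4) (fun y => G y i i) x₀ (K x₀) = - (2 * (c i i * minkowskiEta i i)) :=
    hkill
  -- The full product is `-1` and each entry is its own inverse.
  have hprod : ∀ i, (∏ j ∈ Finset.univ.erase i, (![1, -1, -1, -1] : Fin 4 → ℝ) j)
      = - minkowskiEta i i := by
    intro i
    have h := Finset.mul_prod_erase Finset.univ (![1, -1, -1, -1] : Fin 4 → ℝ) (Finset.mem_univ i)
    fin_cases i <;> simp [Fin.prod_univ_four, minkowskiEta] at h ⊢ <;> linarith
  have heta : ∀ i, minkowskiEta i i * minkowskiEta i i = 1 := by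
    intro i
    fin_cases i <;> simp [minkowskiEta]
  simp only [add_apply, smul_apply, neg_apply, sum_apply, smul_eq_mul, hG, hprod] at hd
  have hs : ∑ i, -minkowskiEta i i * -(2 * (c i i * minkowskiEta i i)) = 2 * ∑ i, c i i := by
    rw [Finset.mul_sum]
    refine Finset.sum_congr rfl fun i _ => ?_
    linear_combination 2 * c i i * heta i
  rw [hs] at hd
  -- The differentiated identity reads `2ρ K(ρ) = -2 ∑ c i i`; multiplying by `ρ/2` and using `ρ² =
  -- 1` isolates `K(ρ)`.
  linear_combination (S.volDensity x₀ b x₀ / 2) * hd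
    - mvfderiv (𝓡 4) (S.volDensity x₀ b) x₀ (K x₀) * hone

/-- The Hodge dual of `g(K, ·)`, read in a chart near its centre. -/
theorem pullback_hodgeStar_lower (K : Π x : M, Tan x) (x₀ : M) (b : Module.Basis (Fin 4) ℝ R4)
    (Ω : R4 [⋀^Fin 4]→L[ℝ] ℝ) (hΩ : Ω b = 1) {y : R4} (hy : y ∈ (extChartAt (𝓡 4) x₀).target) :
    ((S.hodgeStar (S.lower K) ((extChartAt (𝓡 4) x₀).symm y)).compContinuousLinearMap
        (mfderiv 𝓘(ℝ, R4) (𝓡 4) (extChartAt (𝓡 4) x₀).symm y) : R4 [⋀^Fin 3]→L[ℝ] ℝ)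
      = S.volDensity x₀ b ((extChartAt (𝓡 4) x₀).symm y) • Ω.curryLeft (chartRep x₀ K y) := by
  set z := (extChartAt (𝓡 4) x₀).symm y
  set E : R4 →L[ℝ] R4 := mfderiv 𝓘(ℝ, R4) (𝓡 4) (extChartAt (𝓡 4) x₀).symm y with hE
  set τ : R4 [⋀^Fin 4]→L[ℝ] ℝ := S.vol z with hτ
  have hv : ∀ w : Fin 4 → R4, τ (fun i => E (w i)) = S.volDensity x₀ b z * Ω w := by
    intro w
    have h1 := congrArg (fun f => f w)
      ((τ.compContinuousLinearMap E).toAlternatingMap.eq_smul_basis_det b)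
    have h2 := congrArg (fun f => f w) (Ω.toAlternatingMap.eq_smul_basis_det b)
    have h3 : τ (fun i => E (b i)) = S.volDensity x₀ b z :=
      congrArg (S.vol z) (funext fun i => (coordField_symm x₀ (b i) hy).symm)
    have h1' : τ (fun i => E (w i)) = τ (fun i => E (b i)) * b.det w := h1
    have h2' : Ω w = Ω b * b.det w := h2
    rw [h1', h2', h3, hΩ, one_mul]
  ext u
  have hK : E (chartRep x₀ K y) = (S.flat z).symm (S.lower K z) := by
    rw [LorentzianMetric.lower, LinearEquiv.symm_apply_apply]
    exact mfderiv_chartRep x₀ K hy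
  have h := hv (Matrix.vecCons (chartRep x₀ K y) u)
  have e : (fun i => E (Matrix.vecCons (chartRep x₀ K y) u i))
      = Matrix.vecCons ((S.flat z).symm (S.lower K z) : R4) (fun i => E (u i)) := by
    funext i
    refine Fin.cases ?_ (fun j => ?_) i
    · exact hK
    · rfl
  rw [e] at h
  exact h

/-- With `κ` the chart representative of `K`, the pulled-back `⋆K` is `ρ ι_κ Ω` for a constant form
`Ω`. Its exterior derivative on the basis `b` is `κ(ρ) + ρ ∂_i κ^i`, which is zero at the centre of
the chart. -/
theorem codifferential_lower_killing {K : Π x : M, Tan x} (hK : S.IsKilling K) (x₀ : M) :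
    S.codifferential (S.lower K) x₀ = 0 := by
  obtain ⟨o, ho⟩ := S.signature x₀
  obtain ⟨b, hb⟩ := exists_basis_coordField x₀ o
  have hdiv := S.mvfderiv_volDensity_killing hK x₀ b fun i j => by rw [hb, hb, ho]
  set φ := extChartAt (𝓡 4) x₀ with hφ
  set y₀ := φ x₀ with hy₀
  have hy₀t : y₀ ∈ φ.target := mem_extChartAt_target x₀
  have hφx : φ.symm y₀ = x₀ := extChartAt_to_inv x₀
  set pulled : R4 → R4 [⋀^Fin 3]→L[ℝ] ℝ := fun y =>
    (S.hodgeStar (S.lower K) (φ.symm y)).compContinuousLinearMap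
      (mfderiv 𝓘(ℝ, R4) (𝓡 4) φ.symm y)
  have hcont : Continuous fun w : Fin 4 → R4 => b.det w := by
    simp only [Module.Basis.det_apply]
    exact Continuous.matrix_det (continuous_matrix fun i j =>
      (b.coord i).continuous_of_finiteDimensional.comp (continuous_apply j))
  obtain ⟨Ω, hΩ⟩ : ∃ Ω : R4 [⋀^Fin 4]→L[ℝ] ℝ, Ω b = 1 :=
    ⟨{ b.det with cont := hcont }, b.det_self⟩
  set ρ : R4 → ℝ := fun y => S.volDensity x₀ b (φ.symm y) with hρ
  have heq : pulled =ᶠ[𝓝 y₀] fun y => ρ y • Ω.curryLeft (chartRep x₀ K y) :=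
    eventually_of_mem (extChartAt_target_mem_nhds x₀) fun y hy =>
      S.pullback_hodgeStar_lower K x₀ b Ω hΩ hy
  have hρm : MDifferentiableAt (𝓡 4) 𝓘(ℝ, ℝ) (S.volDensity x₀ b) (φ.symm y₀) := by
    rw [hφx]
    exact (S.smoothFunOn_volDensity x₀ b).mdifferentiableAt (isOpen_extChartAt_source x₀)
      (mem_extChartAt_source x₀)
  have hsymm : MDifferentiableAt 𝓘(ℝ, R4) (𝓡 4) φ.symm y₀ := by
    have := mdifferentiableWithinAt_extChartAt_symm (I := 𝓡 4) hy₀t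
    rwa [ModelWithCorners.range_eq_univ, mdifferentiableWithinAt_univ] at this
  have hρd : DifferentiableAt ℝ ρ y₀ := (hρm.comp y₀ hsymm).differentiableAt
  have hκ : DifferentiableAt ℝ (chartRep x₀ K) y₀ := differentiableAt_chartRep x₀ hK.1
  have hLκ : DifferentiableAt ℝ (fun y => Ω.curryLeft (chartRep x₀ K y)) y₀ :=
    Ω.curryLeft.differentiableAt.comp y₀ hκ
  have hρK : fderiv ℝ ρ y₀ (chartRep x₀ K y₀) = mvfderiv (𝓡 4) (S.volDensity x₀ b) x₀ (K x₀) := by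
    have h1 : fderiv ℝ ρ y₀ (chartRep x₀ K y₀)
        = mvfderiv (𝓡 4) (S.volDensity x₀ b) (φ.symm y₀)
          (mfderiv 𝓘(ℝ, R4) (𝓡 4) φ.symm y₀ (chartRep x₀ K y₀)) := by
      refine Eq.trans ?_ (mvfderiv_comp_apply y₀ hρm hsymm (chartRep x₀ K y₀))
      rw [mvfderiv, mfderiv_eq_fderiv]
      rfl
    rw [h1, mfderiv_chartRep x₀ K hy₀t, ← hφ, hφx]
  have hext : extDeriv pulled y₀ b = 0 := by
    rw [heq.extDeriv_eq, extDeriv_apply (hρd.fun_smul hLκ)]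
    -- The alternating sign of the exterior derivative cancels the sign from moving `κ` into the
    -- `i`-th slot of `Ω`.
    have hterm : ∀ i : Fin 4, (-1 : ℤ) ^ (i : ℕ) • fderiv ℝ
          (fun y => (ρ y • Ω.curryLeft (chartRep x₀ K y)) (i.removeNth b)) y₀ (b i)
        = ρ y₀ * b.repr (fderiv ℝ (chartRep x₀ K) y₀ (b i)) i
          + b.repr (chartRep x₀ K y₀) i * fderiv ℝ ρ y₀ (b i) := by
      intro i
      set l : R4 →L[ℝ] ℝ := (b.coord i).toContinuousLinearMap with hl
      have e : (fun y => (ρ y • Ω.curryLeft (chartRep x₀ K y)) (i.removeNth b))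
          = fun y => (-1 : ℝ) ^ (i : ℕ) • (ρ y * l (chartRep x₀ K y)) := by
        funext y
        have h := Ω.toAlternatingMap.map_vecCons_removeNth b i (chartRep x₀ K y)
        have h' : Ω.curryLeft (chartRep x₀ K y) (i.removeNth b)
            = (-1) ^ (i : ℕ) * (b.repr (chartRep x₀ K y) i * Ω b) := h
        simp only [ContinuousAlternatingMap.smul_apply, h', hΩ, smul_eq_mul, hl,
          LinearMap.coe_toContinuousLinearMap', Module.Basis.coord_apply]
        ring
      have hlκ : HasFDerivAt (fun y => l (chartRep x₀ K y)) (l.comp (fderiv ℝ (chartRep x₀ K) y₀))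
          y₀ := l.hasFDerivAt.comp y₀ hκ.hasFDerivAt
      have hm := (hρd.hasFDerivAt.mul hlκ).const_smul ((-1 : ℝ) ^ (i : ℕ))
      rw [e]
      rw [show fderiv ℝ (fun y => (-1 : ℝ) ^ (i : ℕ) • (ρ y * l (chartRep x₀ K y))) y₀ = _
        from hm.fderiv]
      have hsign : (-1 : ℝ) ^ (i : ℕ) * (-1) ^ (i : ℕ) = 1 := by
        rw [← mul_pow]; norm_num
      simp only [zsmul_eq_mul, Int.cast_pow, Int.cast_neg, Int.cast_one, smul_apply, add_apply,
        smul_eq_mul, ← mul_assoc, hsign, one_mul, ContinuousLinearMap.comp_apply, hl,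
        LinearMap.coe_toContinuousLinearMap', Module.Basis.coord_apply]
    have hterm' := Finset.sum_congr (s₁ := Finset.univ) rfl fun i _ => hterm i
    refine Eq.trans ?_ (hterm'.trans ?_)
    · rfl
    rw [Finset.sum_add_distrib, ← Finset.mul_sum]
    have hsum : ∑ i, b.repr (chartRep x₀ K y₀) i * fderiv ℝ ρ y₀ (b i)
        = fderiv ℝ ρ y₀ (chartRep x₀ K y₀) := by
      conv_rhs => rw [← b.sum_repr (chartRep x₀ K y₀)]
      simp only [map_sum, map_smul, smul_eq_mul]
    have hρ0 : ρ y₀ = S.volDensity x₀ b x₀ := congrArg (S.volDensity x₀ b) hφx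
    rw [hsum, hρK, hρ0, add_comm]
    exact hdiv
  -- A top-degree form is determined by its value on one basis.
  have hzero : ∀ w, extDeriv pulled y₀ w = 0 := by
    intro w
    have h := congrArg (fun f => f w) ((extDeriv pulled y₀).toAlternatingMap.eq_smul_basis_det b)
    have h' : extDeriv pulled y₀ w = extDeriv pulled y₀ b * b.det w := h
    rw [h', hext, zero_mul]
  have hnum : ∀ w, manifoldExtDeriv (S.hodgeStar (S.lower K)) x₀ w = 0 := fun w => hzero _
  rw [codifferential, hodgeStarInv, neg_eq_zero]
  exact (congrArg (· / _) (hnum _)).trans (zero_div _)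

end Spacetime

end

theorem proposition1 {M : Type*} [TopologicalSpace M] [ChartedSpace R4 M]
    [IsManifold (𝓡 4) ∞ M] (S : Spacetime M) (K : Π x : M, Tan x) (hK : S.IsKilling K) :
    (∀ x : M, S.codifferential (S.lower K) x = 0) ∧
    ∀ (F : LocalFrame M), ∀ x ∈ F.U,
      (∀ α, S.ricciOperator F (F.coframe α) x
        = CliffordAlgebra.ι (S.coquad x) (S.ricciForm F α x)) ∧
      S.ricciOperator F (S.lower K) x
        = CliffordAlgebra.ι (S.coquad x)
            (∑ α, S.lower K x (F.e α x) • S.ricciForm F α x) ∧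
      S.dAlembertian F (S.lower K) x
        = ∑ α, S.lower K x (F.e α x) • S.ricciForm F α x := by
  refine ⟨S.codifferential_lower_killing hK, fun F x hx => ⟨fun α => ?_, ?_, ?_⟩⟩
  · rw [S.ricciOperator_eq F (F.smoothFormOn_coframe S.toLorentzianMetric α) hx]
    simp [F.coframe_frame hx]
  · exact S.ricciOperator_eq F (S.smoothFormOn_lower (ContMDiffOn.mono hK.1 (Set.subset_univ _))) hx
  · exact S.dAlembertian_killing F hK hx
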